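/- Let $L$ be a $2\times 2$ integer matrix with determinant $1$ and no eigenvalue of absolute value $1$, let $T:\mathbb T^2\to\mathbb T^2$ be the map it induces on the flat torus $\mathbb T^2=\mathbb R^2/\mathbb Z^2$, and let $m$ be Lebesgue (Haar probability) measure on $\mathbb T^2$. Let $\lambda$ and $1/\lambda$, with $|\lambda|>1$, be the eigenvalues of $L$, and let $e^u$, $e^s$ be Euclidean unit eigenvectors for $\lambda$ and $1/\lambda$ respectively. Let $d^*$ be the metric on $\mathbb T^2$ obtained by projecting the metric of the norm $\|x^u e^u+x^s e^s\|_*=\max\{|x^u|,|x^s|\}$ on $\mathbb R^2$, that is, $d^*(z,w)=\inf\{\|v\|_*: v\in\mathbb R^2,\ v \bmod \mathbb Z^2=z-w\}$. Fix $\zeta\in\mathbb T^2$ and put $\varphi(z)=-\log d^*(z,\zeta)\in\mathbb R\cup\{+\infty\}$ (with $\varphi(\zeta)=+\infty$), $X_i=\varphi\circ T^i$ for $i\ge 0$, and $M_n=\max\{X_0,\dots,X_{n-1}\}$. Let $\tau\ge 0$ and let $(u_n)_{n\in\mathbb N}$ be a sequence of real numbers with $\lim_{n\to\infty} n\,m(X_0>u_n)=\tau$.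 Then: 1. if $\zeta$ is not a periodic point of $T$, then $\lim_{n\to\infty} m(M_n\le u_n)=e^{-\tau}$; 2. if $\zeta$ is periodic of prime (that is, minimal) period $q$, then $\lim_{n\to\infty} m(M_n\le u_n)=e^{-\vartheta\tau}$ with $\vartheta=1-|\lambda|^{-q}$. -/

import Mathlib

open MeasureTheory Filter Topology

/-- An integer `2 × 2` matrix of determinant `1` none of whose (complex) eigenvalues has absolute
value `1`. These are the matrices that induce the linear Anosov diffeomorphisms of the torus. -/
structure IsHyperbolicMatrix (L : Matrix (Fin 2) (Fin 2) ℤ) : Prop where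
  det_eq_one : L.det = 1
  norm_ne_one : ∀ μ ∈ spectrum ℂ (L.map (Int.cast : ℤ → ℂ)), ‖μ‖ ≠ 1

/-- The canonical projection `ℝ² → 𝕋² = ℝ² / ℤ²`. -/
def torusProj (v : EuclideanSpace ℝ (Fin 2)) : UnitAddTorus (Fin 2) :=
  fun i => ((v i : ℝ) : UnitAddCircle)

/-- The self-map of the torus `𝕋² = ℝ² / ℤ²` induced by the integer matrix `L`. -/
def toralMap (L : Matrix (Fin 2) (Fin 2) ℤ) (z : UnitAddTorus (Fin 2)) : UnitAddTorus (Fin 2) :=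
  fun i => ∑ j, L i j • z j

/-- `toralMap L` is indeed the map that `v ↦ L v` induces through the projection. -/
theorem toralMap_torusProj (L : Matrix (Fin 2) (Fin 2) ℤ) (v : EuclideanSpace ℝ (Fin 2)) :
    toralMap L (torusProj v) =
      torusProj (WithLp.toLp 2 ((L.map (Int.cast : ℤ → ℝ)).mulVec v.ofLp)) := by
  funext i
  simp [toralMap, torusProj, Matrix.mulVec, dotProduct, Fin.sum_univ_two, ← zsmul_eq_mul]

/-- The adapted metric on the torus: the projection to `𝕋²` of the metric of `ℝ²` given by the
norm `max |x^u| |x^s|`, where `(x^u, x^s)` are the coordinates of a vector in the basis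
`(eu, es)`. That is, `d*(z, w)` is the least norm of a vector that projects to `z - w`. -/
noncomputable def dStar (eu es : EuclideanSpace ℝ (Fin 2)) (z w : UnitAddTorus (Fin 2)) : ℝ :=
  sInf {r : ℝ | ∃ xu xs : ℝ, torusProj (xu • eu + xs • es) = z - w ∧ r = max |xu| |xs|}

/-- The observable `φ(z) = -log d*(z, ζ)` with values in `ℝ ∪ {+∞}`; it equals `+∞` where the
distance vanishes. -/
noncomputable def observable (eu es : EuclideanSpace ℝ (Fin 2)) (ζ z : UnitAddTorus (Fin 2)) :
    EReal :=
  -ENNReal.log (ENNReal.ofReal (dStar eu es z ζ))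

/-- The stochastic process `X_i = φ ∘ T^i`. -/
noncomputable def process (L : Matrix (Fin 2) (Fin 2) ℤ) (eu es : EuclideanSpace ℝ (Fin 2))
    (ζ : UnitAddTorus (Fin 2)) (i : ℕ) (z : UnitAddTorus (Fin 2)) : EReal :=
  observable eu es ζ ((toralMap L)^[i] z)

/-- The partial maxima `M_n = max {X_0, …, X_{n-1}}` (with `M_0 = -∞`). -/
noncomputable def partialMax (L : Matrix (Fin 2) (Fin 2) ℤ) (eu es : EuclideanSpace ℝ (Fin 2))
    (ζ : UnitAddTorus (Fin 2)) (n : ℕ) (z : UnitAddTorus (Fin 2)) : EReal :=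
  (Finset.range n).sup fun i => process L eu es ζ i z

/-! In the coordinates of the eigenbasis, `M_n ≤ u_n` says that the first `n` iterates avoid the box
`B_n` of half-side `r_n = exp (-u_n)` about `ζ`. The chart gives `m(B_n) = 4 κ r_n²` for small
`r_n`, with `κ = |det (eu, es)|`, so `n r_n²` converges. What is needed is an exponential
hitting-time law for shrinking sets.

Such a law follows from a recursion (`tendsto_measureReal_avoiding`). If `W_l` is the set of points
avoiding `A` for `l` steps, then `m(W_{l+1}) = m(W_l) - m(A ∩ T⁻¹ W_l)`, which is nearly `(1 - m(A))
m(W_l)` when `A` rarely returns to itself within `t` steps and is nearly independent of `T^{-t}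
W_l`. If `n` times the errors tends to zero, `m(W_n)` behaves like `(1 - m(A))^n`.

Independence (`abs_mixing_le`) comes from splitting the lag `2k` evenly: `T^k A` is nearly invariant
under long unstable translations and `T^{-k} W` under long stable ones. The correlation therefore
hardly changes when one set is translated by a vector of a large square, and its average over the
square is nearly the product of the measures.

Returns at bounded times are excluded by continuity. For later ones, nonzero lattice vectors satisfy
`|x^u x^s| ≥ η`, so the unstable coordinates of returning points lie in short, well separated
clusters (`measureReal_return_le`).

If `ζ` has period `q`, the box does return to itself. It is replaced by the ring `|λ|^{-q} r ≤ |x^u|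
< r` of points that leave the box after `q` steps, whose measure is `ϑ m(B_n)`. A point that visits
the box and avoids the ring stays in the box at every `q`-th step, so avoiding the ring and avoiding
the box differ only through the last `q` times (`abs_avoiding_target_sub_le`). -/

/-! ### Linear charts of the torus -/

/-- The homomorphism `ℝ² → 𝕋²` given by the coordinates in the basis `(eu, es)`. -/
noncomputable def basisHom (eu es : EuclideanSpace ℝ (Fin 2)) :
    ℝ × ℝ →+ UnitAddTorus (Fin 2) where
  toFun w := torusProj (w.1 • eu + w.2 • es)
  map_zero' := by funext i; simp [torusProj]
  map_add' v w := by
    funext i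
    simp only [torusProj, Prod.fst_add, Prod.snd_add, PiLp.add_apply, PiLp.smul_apply, smul_eq_mul,
      Pi.add_apply, ← AddCircle.coe_add]
    congr 1
    ring

/-- A homomorphism `ℝ² → 𝕋²` that is a local chart: up to the scalar `density`, it carries Lebesgue
measure on the bounded set `domain`, on which it is injective, to Haar measure. -/
structure TorusChart (h : ℝ × ℝ →+ UnitAddTorus (Fin 2)) where
  continuous : Continuous h
  surjective : Function.Surjective h
  density : ℝ
  density_pos : 0 < density
  domain : Set (ℝ × ℝ)
  measurableSet_domain : MeasurableSet domain
  bound : ℝ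
  bound_pos : 0 < bound
  abs_coord_le : ∀ w ∈ domain, |w.1| ≤ bound ∧ |w.2| ≤ bound
  injOn : Set.InjOn h domain
  center : ℝ × ℝ
  radius : ℝ
  radius_pos : 0 < radius
  center_add_mem : ∀ w : ℝ × ℝ, |w.1| < radius → |w.2| < radius → center + w ∈ domain
  map_restrict : Measure.map h (volume.restrict domain) = (ENNReal.ofReal density)⁻¹ • volume

/-- The linear map `ℝ × ℝ → ℝ²` given by the coordinates in the basis `(eu, es)`. -/
def basisLin (eu es : EuclideanSpace ℝ (Fin 2)) : ℝ × ℝ →ₗ[ℝ] (Fin 2 → ℝ) where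
  toFun w := fun i => w.1 * eu i + w.2 * es i
  map_add' v w := by funext i; simp only [Prod.fst_add, Prod.snd_add, Pi.add_apply]; ring
  map_smul' c w := by
    funext i; simp only [Prod.smul_fst, Prod.smul_snd, smul_eq_mul, Pi.smul_apply, RingHom.id_apply]
    ring

theorem basisHom_apply (eu es : EuclideanSpace ℝ (Fin 2)) (w : ℝ × ℝ) (i : Fin 2) :
    basisHom eu es w i = ((basisLin eu es w i : ℝ) : UnitAddCircle) := by
  simp [basisHom, torusProj, basisLin]

/-! ### The chart given by a basis of the plane. -/

section basis
variable {eu es : EuclideanSpace ℝ (Fin 2)} (hd : eu 0 * es 1 - es 0 * eu 1 ≠ 0)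
include hd

theorem fst_eq_of_basisLin (w : ℝ × ℝ) :
    w.1 = (basisLin eu es w 0 * es 1 - basisLin eu es w 1 * es 0) /
      (eu 0 * es 1 - es 0 * eu 1) := by
  rw [eq_div_iff hd]; simp only [basisLin, LinearMap.coe_mk, AddHom.coe_mk]; ring

theorem snd_eq_of_basisLin (w : ℝ × ℝ) :
    w.2 = (basisLin eu es w 1 * eu 0 - basisLin eu es w 0 * eu 1) /
      (eu 0 * es 1 - es 0 * eu 1) := by
  rw [eq_div_iff hd]; simp only [basisLin, LinearMap.coe_mk, AddHom.coe_mk]; ring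

theorem basisLin_injective : Function.Injective (basisLin eu es) := by
  intro v w hvw
  ext
  · rw [fst_eq_of_basisLin hd v, hvw, ← fst_eq_of_basisLin hd w]
  · rw [snd_eq_of_basisLin hd v, hvw, ← snd_eq_of_basisLin hd w]

theorem basisLin_surjective : Function.Surjective (basisLin eu es) :=
  ((basisLin eu es).injective_iff_surjective_of_finrank_eq_finrank (by simp)).1
    (basisLin_injective hd)

theorem map_basisLin_volume :
    Measure.map (basisLin eu es) volume =
      (ENNReal.ofReal |eu 0 * es 1 - es 0 * eu 1|)⁻¹ • volume := by
  have hM : (!![eu 0, es 0; eu 1, es 1] : Matrix (Fin 2) (Fin 2) ℝ).det ≠ 0 := by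
    rw [Matrix.det_fin_two_of]; exact hd
  have h1 := Real.map_matrix_volume_pi_eq_smul_volume_pi hM
  have h2 := (volume_preserving_finTwoArrow ℝ).symm
  have h3 : (basisLin eu es : ℝ × ℝ → Fin 2 → ℝ) =
      Matrix.toLin' !![eu 0, es 0; eu 1, es 1] ∘ (MeasurableEquiv.finTwoArrow (α := ℝ)).symm := by
    funext w i
    fin_cases i <;> simp [basisLin, MeasurableEquiv.finTwoArrow, Matrix.mulVec, dotProduct,
      Fin.sum_univ_two] <;> ring
  have hc : Continuous (Matrix.toLin' (!![eu 0, es 0; eu 1, es 1] : Matrix (Fin 2) (Fin 2) ℝ)) :=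
    LinearMap.continuous_of_finiteDimensional _
  rw [h3, ← Measure.map_map hc.measurable h2.measurable, h2.map_eq, h1,
    Matrix.det_fin_two_of, abs_inv, ENNReal.ofReal_inv_of_pos (abs_pos.2 hd)]

/-- The chart given by a basis of `ℝ²`. -/
noncomputable def basisChart : TorusChart (basisHom eu es) := by
  have hA : Continuous (basisLin eu es) := LinearMap.continuous_of_finiteDimensional _
  let p : (Fin 2 → ℝ) → UnitAddTorus (Fin 2) := fun v i => (v i : UnitAddCircle)
  have hfac : (basisHom eu es : ℝ × ℝ → UnitAddTorus (Fin 2)) = p ∘ basisLin eu es := by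
    funext w i; exact basisHom_apply eu es w i
  have hp : Continuous p :=
    continuous_pi fun i => (AddCircle.continuous_mk' (1 : ℝ)).comp (continuous_apply i)
  -- The half-open unit square is an exact fundamental domain of `ℤ²`: this gives both the
  -- injectivity and the image measure.
  let Q : Set (Fin 2 → ℝ) := Set.univ.pi fun _ => Set.Ioc 0 1
  have hQ : MeasurableSet Q := MeasurableSet.univ_pi fun _ => measurableSet_Ioc
  have hcen : ∃ c : ℝ × ℝ, ∃ r : ℝ, 0 < r ∧
      ∀ w : ℝ × ℝ, |w.1| < r → |w.2| < r → c + w ∈ basisLin eu es ⁻¹' Q := by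
    obtain ⟨c, hc⟩ := basisLin_surjective hd (fun _ => 1 / 2)
    have ho : IsOpen (basisLin eu es ⁻¹' Set.univ.pi fun _ => Set.Ioo (0 : ℝ) 1) :=
      (isOpen_set_pi Set.finite_univ fun _ _ => isOpen_Ioo).preimage hA
    obtain ⟨r, hr, hb⟩ := Metric.isOpen_iff.1 ho c (by
      rw [Set.mem_preimage, hc]; intro i _; constructor <;> norm_num)
    refine ⟨c, r, hr, fun w h1 h2 => ?_⟩
    have := hb (show c + w ∈ Metric.ball c r by
      rw [Metric.mem_ball, dist_eq_norm, add_sub_cancel_left, Prod.norm_def]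
      exact max_lt h1 h2)
    exact fun i hi => Set.Ioo_subset_Ioc_self (this i hi)
  exact
  { continuous := by rw [hfac]; exact hp.comp hA
    surjective := by
      rw [hfac]
      refine Function.Surjective.comp (fun z => ?_) (basisLin_surjective hd)
      choose v hv using fun i => QuotientAddGroup.mk_surjective (z i)
      exact ⟨v, funext hv⟩
    density := |eu 0 * es 1 - es 0 * eu 1|
    density_pos := abs_pos.2 hd
    domain := basisLin eu es ⁻¹' Q
    measurableSet_domain := hA.measurable hQ
    -- Cramer's rule bounds each coordinate by two of the four entries over the determinant; one
    -- constant serves both, and the `+ 1` makes it visibly positive.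
    bound := (|eu 0| + |eu 1| + |es 0| + |es 1| + 1) / |eu 0 * es 1 - es 0 * eu 1|
    bound_pos := by have := abs_pos.2 hd; positivity
    abs_coord_le := by
      intro w hw
      have key : ∀ x y a b : ℝ, x ∈ Set.Ioc (0 : ℝ) 1 → y ∈ Set.Ioc (0 : ℝ) 1 →
          |x * a - y * b| ≤ |a| + |b| := by
        intro x y a b hx hy
        refine (abs_sub _ _).trans ?_
        rw [abs_mul, abs_mul, abs_of_pos hx.1, abs_of_pos hy.1]
        have := hx.2; have := hy.2
        have := abs_nonneg a; have := abs_nonneg b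
        nlinarith
      have h0 := hw 0 (Set.mem_univ _)
      have h1 := hw 1 (Set.mem_univ _)
      have hpos := abs_pos.2 hd
      constructor
      · rw [fst_eq_of_basisLin hd w, abs_div]
        gcongr
        have := key _ _ (es 1) (es 0) h0 h1
        have := abs_nonneg (eu 0); have := abs_nonneg (eu 1)
        linarith
      · rw [snd_eq_of_basisLin hd w, abs_div]
        gcongr
        have := key _ _ (eu 0) (eu 1) h1 h0
        have := abs_nonneg (es 0); have := abs_nonneg (es 1)
        linarith
    injOn := by
      intro v hv w hw hvw
      refine basisLin_injective hd (funext fun i => ?_)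
      have h1 := congrFun hvw i
      rw [basisHom_apply, basisHom_apply] at h1
      rw [← sub_eq_zero, ← AddCircle.coe_sub, AddCircle.coe_eq_zero_iff] at h1
      obtain ⟨n, hn⟩ := h1
      have hvi := hv i (Set.mem_univ _)
      have hwi := hw i (Set.mem_univ _)
      rw [zsmul_eq_mul, mul_one] at hn
      have h2 : (n : ℝ) < 1 := by linarith [hvi.2, hwi.1]
      have h3 : (-1 : ℝ) < n := by linarith [hvi.1, hwi.2]
      have h4 : n < 1 := by exact_mod_cast h2
      have h5 : -1 < n := by exact_mod_cast h3
      obtain rfl : n = 0 := by omega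
      rw [Int.cast_zero] at hn
      linarith
    center := hcen.choose
    radius := hcen.choose_spec.choose
    radius_pos := hcen.choose_spec.choose_spec.1
    center_add_mem := hcen.choose_spec.choose_spec.2
    map_restrict := by
      have hm : MeasurePreserving p (volume.restrict Q) volume := by
        have := measurePreserving_pi (fun _ : Fin 2 => volume.restrict (Set.Ioc (0 : ℝ) 1))
          (fun _ : Fin 2 => (volume : Measure UnitAddCircle))
          (f := fun _ => ((↑) : ℝ → UnitAddCircle))
          (fun _ => by simpa using UnitAddCircle.measurePreserving_mk 0)
        rwa [← Measure.restrict_pi_pi] at this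
      rw [hfac, ← Measure.map_map hp.measurable hA.measurable,
        ← Measure.restrict_map hA.measurable hQ, map_basisLin_volume hd, Measure.restrict_smul,
        Measure.map_smul, hm.map_eq] }
end basis

/-! ### The toral automorphism -/

namespace TorusChart
variable {h : ℝ × ℝ →+ UnitAddTorus (Fin 2)} (c : TorusChart h)
include c

/-- The domain contains a box about `center`, so injectivity there makes the kernel discrete at the
origin. -/
theorem eq_zero_of_map_eq_zero {w : ℝ × ℝ} (h1 : |w.1| < c.radius) (h2 : |w.2| < c.radius)
    (hw : h w = 0) : w = 0 := by
  have h3 := c.injOn (c.center_add_mem w h1 h2)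
    (c.center_add_mem 0 (by simpa using c.radius_pos) (by simpa using c.radius_pos))
    (by simp [hw])
  simpa using h3

end TorusChart

/-- The endomorphism of the torus induced by an integer matrix. -/
def toralHom (L : Matrix (Fin 2) (Fin 2) ℤ) : UnitAddTorus (Fin 2) →+ UnitAddTorus (Fin 2) where
  toFun := toralMap L
  map_zero' := by funext i; simp [toralMap]
  map_add' x y := by funext i; simp [toralMap, Finset.sum_add_distrib]

theorem toralMap_mul (L M : Matrix (Fin 2) (Fin 2) ℤ) (z : UnitAddTorus (Fin 2)) :
    toralMap (L * M) z = toralMap L (toralMap M z) := by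
  funext i
  simp only [toralMap, Matrix.mul_apply, Fin.sum_univ_two, smul_add, add_smul, mul_smul]
  abel

theorem toralMap_one (z : UnitAddTorus (Fin 2)) : toralMap 1 z = z := by
  funext i
  simp [toralMap, Matrix.one_apply, ite_smul]

theorem continuous_toralMap (L : Matrix (Fin 2) (Fin 2) ℤ) : Continuous (toralMap L) :=
  continuous_pi fun _ => continuous_finsetSum _ fun j _ =>
    (continuous_zsmul _).comp (continuous_apply j)

/-- Mutually inverse measure-preserving automorphisms `T` and `S` of the torus, of which the first
is `(a, b) ↦ (lam a, lam⁻¹ b)` in the chart `h`. -/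
structure IsHyperbolicPair (h : ℝ × ℝ →+ UnitAddTorus (Fin 2)) (lam : ℝ)
    (T S : UnitAddTorus (Fin 2) →+ UnitAddTorus (Fin 2)) : Prop where
  one_lt : 1 < |lam|
  map_chart : ∀ w : ℝ × ℝ, T (h w) = h (lam * w.1, lam⁻¹ * w.2)
  inv_map : ∀ z, S (T z) = z
  map_inv : ∀ z, T (S z) = z
  continuous : Continuous T
  continuous_inv : Continuous S

theorem toralMap_basisHom {L : Matrix (Fin 2) (Fin 2) ℤ} {lam : ℝ}
    {eu es : EuclideanSpace ℝ (Fin 2)}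
    (heu : (L.map (Int.cast : ℤ → ℝ)).mulVec eu.ofLp = lam • eu.ofLp)
    (hes : (L.map (Int.cast : ℤ → ℝ)).mulVec es.ofLp = lam⁻¹ • es.ofLp) (w : ℝ × ℝ) :
    toralMap L (basisHom eu es w) = basisHom eu es (lam * w.1, lam⁻¹ * w.2) := by
  change toralMap L (torusProj _) = torusProj _
  rw [toralMap_torusProj]
  congr 1
  ext i
  simp only [WithLp.ofLp_add, WithLp.ofLp_smul, Matrix.mulVec_add, Matrix.mulVec_smul, heu, hes,
    Pi.add_apply, Pi.smul_apply, smul_eq_mul, PiLp.add_apply, PiLp.smul_apply]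
  ring

theorem isHyperbolicPair_toralHom {L : Matrix (Fin 2) (Fin 2) ℤ} (hL : L.det = 1) {lam : ℝ}
    (hlam : 1 < |lam|) {eu es : EuclideanSpace ℝ (Fin 2)}
    (heu : (L.map (Int.cast : ℤ → ℝ)).mulVec eu.ofLp = lam • eu.ofLp)
    (hes : (L.map (Int.cast : ℤ → ℝ)).mulVec es.ofLp = lam⁻¹ • es.ofLp) :
    IsHyperbolicPair (basisHom eu es) lam (toralHom L) (toralHom L.adjugate) where
  one_lt := hlam
  map_chart := toralMap_basisHom heu hes
  inv_map z := by
    change toralMap _ (toralMap _ z) = z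
    rw [← toralMap_mul, Matrix.adjugate_mul, hL, one_smul, toralMap_one]
  map_inv z := by
    change toralMap _ (toralMap _ z) = z
    rw [← toralMap_mul, Matrix.mul_adjugate, hL, one_smul, toralMap_one]
  continuous := continuous_toralMap L
  continuous_inv := continuous_toralMap _

theorem eigenbasis_det_ne_zero {L : Matrix (Fin 2) (Fin 2) ℤ} {lam : ℝ}
    (hlam : 1 < |lam|) {eu es : EuclideanSpace ℝ (Fin 2)} (heu0 : ‖eu‖ = 1) (hes0 : ‖es‖ = 1)
    (heu : (L.map (Int.cast : ℤ → ℝ)).mulVec eu.ofLp = lam • eu.ofLp)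
    (hes : (L.map (Int.cast : ℤ → ℝ)).mulVec es.ofLp = lam⁻¹ • es.ofLp) :
    eu 0 * es 1 - es 0 * eu 1 ≠ 0 := by
  intro hD
  have hl0 : lam ≠ 0 := by rintro rfl; norm_num at hlam
  have hne : lam - lam⁻¹ ≠ 0 := by
    intro h
    have h1 : lam * lam = 1 := by field_simp at h; nlinarith
    nlinarith [abs_mul_abs_self lam]
  have e0 := congrFun heu 0
  have e1 := congrFun heu 1
  have s0 := congrFun hes 0
  have s1 := congrFun hes 1
  simp only [Matrix.mulVec, dotProduct, Fin.sum_univ_two, Matrix.map_apply, Pi.smul_apply,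
    smul_eq_mul] at e0 e1 s0 s1
  have hnu : eu 0 ^ 2 + eu 1 ^ 2 = 1 := by
    have := EuclideanSpace.norm_sq_eq eu
    rw [heu0, Fin.sum_univ_two] at this; simpa using this.symm
  have hns : es 0 ^ 2 + es 1 ^ 2 = 1 := by
    have := EuclideanSpace.norm_sq_eq es
    rw [hes0, Fin.sum_univ_two] at this; simpa using this.symm
  -- Pairing each eigenvector equation with the other vector leaves an off-diagonal entry times the
  -- determinant, assumed zero. Hence all products `eu i * es j` vanish, against both norms being
  -- one.
  have k00 : (lam - lam⁻¹) * (eu 0 * es 0) = 0 := by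
    linear_combination (-es 0) * e0 + eu 0 * s0 - (L 0 1 : ℝ) * hD
  have k11 : (lam - lam⁻¹) * (eu 1 * es 1) = 0 := by
    linear_combination (-es 1) * e1 + eu 1 * s1 + (L 1 0 : ℝ) * hD
  have k00' := (mul_eq_zero.1 k00).resolve_left hne
  have k11' := (mul_eq_zero.1 k11).resolve_left hne
  have : (eu 0 ^ 2 + eu 1 ^ 2) * (es 0 ^ 2 + es 1 ^ 2) = 0 := by
    have hD' : eu 0 * es 1 = es 0 * eu 1 := by linarith
    have : (eu 0 * es 1) * (eu 0 * es 1) = 0 := by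
      nth_rewrite 2 [hD']; linear_combination (es 1 * eu 1) * k00'
    have h4 : eu 0 * es 1 = 0 := mul_self_eq_zero.1 this
    have h5 : es 0 * eu 1 = 0 := by linarith
    linear_combination eu 0 * es 0 * k00' + eu 1 * es 1 * k11' + eu 0 * es 1 * h4 + es 0 * eu 1 * h5
  rw [hnu, hns] at this
  norm_num at this

/-! ### Expansion, contraction and the lattice. -/

namespace IsHyperbolicPair
variable {h : ℝ × ℝ →+ UnitAddTorus (Fin 2)} {lam : ℝ}
  {T S : UnitAddTorus (Fin 2) →+ UnitAddTorus (Fin 2)} (H : IsHyperbolicPair h lam T S)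
include H

theorem ne_zero : lam ≠ 0 := by rintro rfl; have := H.one_lt; norm_num at this

theorem inv_chart (w : ℝ × ℝ) : S (h w) = h (lam⁻¹ * w.1, lam * w.2) := by
  have := H.map_chart (lam⁻¹ * w.1, lam * w.2)
  rw [mul_inv_cancel_left₀ H.ne_zero, inv_mul_cancel_left₀ H.ne_zero] at this
  change T _ = h w at this
  rw [← this, H.inv_map]

theorem symm_pow_chart (n : ℕ) (w : ℝ × ℝ) :
    S^[n] (h w) = h (lam⁻¹ ^ n * w.1, lam ^ n * w.2) := by
  induction n with
  | zero => simp
  | succ n ih => rw [Function.iterate_succ_apply', ih, H.inv_chart]; congr 2 <;> ring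

theorem pow_chart (n : ℕ) (w : ℝ × ℝ) :
    T^[n] (h w) = h (lam ^ n * w.1, lam⁻¹ ^ n * w.2) := by
  induction n with
  | zero => simp
  | succ n ih => rw [Function.iterate_succ_apply', ih, H.map_chart]; congr 2 <;> ring

theorem measurePreserving : MeasurePreserving T volume volume :=
  AddMonoidHom.measurePreserving H.continuous (fun z => ⟨S z, H.map_inv z⟩) rfl

theorem measurePreserving_inv : MeasurePreserving S volume volume :=
  AddMonoidHom.measurePreserving H.continuous_inv (fun z => ⟨T z, H.inv_map z⟩) rfl

theorem inv_lt_one : |lam⁻¹| < 1 := by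
  rw [abs_inv]; exact inv_lt_one_of_one_lt₀ H.one_lt

/-- A nonzero kernel vector on the contracted axis would have nonzero iterates in the kernel tending
to the origin. The other axis is treated with `S`. -/
theorem fst_ne_zero (c : TorusChart h) {w : ℝ × ℝ} (hw : h w = 0) (hw0 : w ≠ 0) : w.1 ≠ 0 := by
  intro h1
  have h2 : w.2 ≠ 0 := fun h2 => hw0 (Prod.ext h1 h2)
  have ht : Tendsto (fun n : ℕ => |lam⁻¹ ^ n * w.2|) atTop (𝓝 0) := by
    have := ((tendsto_pow_atTop_nhds_zero_of_abs_lt_one H.inv_lt_one).mul_const w.2).abs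
    simpa using this
  obtain ⟨n, hn⟩ := (ht.eventually (gt_mem_nhds c.radius_pos)).exists
  have h3 : h (lam ^ n * w.1, lam⁻¹ ^ n * w.2) = 0 := by
    rw [← H.pow_chart, hw]; exact iterate_map_zero T n
  have h4 := c.eq_zero_of_map_eq_zero (w := (lam ^ n * w.1, lam⁻¹ ^ n * w.2))
    (by simpa [h1] using c.radius_pos) hn h3
  have h5 : lam⁻¹ ^ n * w.2 = 0 := congrArg Prod.snd h4
  exact mul_ne_zero (pow_ne_zero _ (inv_ne_zero H.ne_zero)) h2 h5

theorem snd_ne_zero (c : TorusChart h) {w : ℝ × ℝ} (hw : h w = 0) (hw0 : w ≠ 0) : w.2 ≠ 0 := by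
  intro h1
  have h2 : w.1 ≠ 0 := fun h2 => hw0 (Prod.ext h2 h1)
  have ht : Tendsto (fun n : ℕ => |lam⁻¹ ^ n * w.1|) atTop (𝓝 0) := by
    have := ((tendsto_pow_atTop_nhds_zero_of_abs_lt_one H.inv_lt_one).mul_const w.1).abs
    simpa using this
  obtain ⟨n, hn⟩ := (ht.eventually (gt_mem_nhds c.radius_pos)).exists
  have h3 : h (lam⁻¹ ^ n * w.1, lam ^ n * w.2) = 0 := by
    rw [← H.symm_pow_chart, hw]; exact iterate_map_zero S n
  have h4 := c.eq_zero_of_map_eq_zero (w := (lam⁻¹ ^ n * w.1, lam ^ n * w.2))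
    hn (by simpa [h1] using c.radius_pos) h3
  have h5 : lam⁻¹ ^ n * w.1 = 0 := congrArg Prod.fst h4
  exact mul_ne_zero (pow_ne_zero _ (inv_ne_zero H.ne_zero)) h2 h5

end IsHyperbolicPair

/-- The nonzero vectors of the lattice stay away from the axes hyperbolically: the product of the
coordinates is, up to a constant, a nonzero integer. -/
theorem IsHyperbolicPair.exists_le_abs_mul {eu es : EuclideanSpace ℝ (Fin 2)}
    (hd : eu 0 * es 1 - es 0 * eu 1 ≠ 0) {lam : ℝ}
    {T S : UnitAddTorus (Fin 2) →+ UnitAddTorus (Fin 2)}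
    (H : IsHyperbolicPair (basisHom eu es) lam T S) :
    ∃ δ > 0, ∀ w, basisHom eu es w = 0 → w ≠ 0 → δ ≤ |w.1| * |w.2| := by
  have hl0 := H.ne_zero
  have hne : lam⁻¹ - lam ≠ 0 := by
    intro h
    have h1 : lam * lam = 1 := by field_simp at h; nlinarith
    have := H.one_lt
    nlinarith [abs_mul_abs_self lam]
  have hK : 0 < |(eu 0 * es 1 - es 0 * eu 1) * (lam⁻¹ - lam)| := abs_pos.2 (mul_ne_zero hd hne)
  refine ⟨|(eu 0 * es 1 - es 0 * eu 1) * (lam⁻¹ - lam)|⁻¹, inv_pos.2 hK, fun w hw hw0 => ?_⟩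
  have hint : ∀ v, basisHom eu es v = 0 → ∀ i, ∃ n : ℤ, (n : ℝ) = basisLin eu es v i := by
    intro v hv i
    have h1 := congrFun hv i
    rw [basisHom_apply, Pi.zero_apply, AddCircle.coe_eq_zero_iff] at h1
    obtain ⟨n, hn⟩ := h1
    exact ⟨n, by simpa using hn⟩
  choose p hp using hint w hw
  choose p' hp' using hint (lam * w.1, lam⁻¹ * w.2) (by rw [← H.map_chart, hw, map_zero])
  -- The left side is the determinant of a lattice vector and its image under the automorphism,
  -- hence an integer.
  have hkey : ((p 0 * p' 1 - p 1 * p' 0 : ℤ) : ℝ) =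
      (eu 0 * es 1 - es 0 * eu 1) * (lam⁻¹ - lam) * (w.1 * w.2) := by
    push_cast
    rw [hp, hp, hp', hp']
    simp only [basisLin, LinearMap.coe_mk, AddHom.coe_mk]
    ring
  have hne0 : p 0 * p' 1 - p 1 * p' 0 ≠ 0 := by
    intro h0
    rw [h0, Int.cast_zero] at hkey
    have := mul_ne_zero (mul_ne_zero hd hne) (mul_ne_zero
      (H.fst_ne_zero (basisChart hd) hw hw0) (H.snd_ne_zero (basisChart hd) hw hw0))
    exact this hkey.symm
  have h1 : (1 : ℝ) ≤ |((p 0 * p' 1 - p 1 * p' 0 : ℤ) : ℝ)| := by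
    rw [← Int.cast_abs]; exact_mod_cast Int.one_le_abs hne0
  rw [hkey, abs_mul, abs_mul w.1] at h1
  rwa [inv_le_iff_one_le_mul₀' hK]

/-! ### Measure estimates in a chart -/

/-- The closed square of half-side `R` centred at the origin. -/
def square (R : ℝ) : Set (ℝ × ℝ) := Set.Icc (-R) R ×ˢ Set.Icc (-R) R

theorem measurableSet_square (R : ℝ) : MeasurableSet (square R) :=
  measurableSet_Icc.prod measurableSet_Icc

theorem mem_square {R : ℝ} {w : ℝ × ℝ} : w ∈ square R ↔ |w.1| ≤ R ∧ |w.2| ≤ R := by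
  simp only [square, Set.mem_prod, Set.mem_Icc, abs_le]

theorem volume_square {R : ℝ} (hR : 0 ≤ R) : volume (square R) = ENNReal.ofReal ((2 * R) ^ 2) := by
  rw [square, Measure.volume_eq_prod, Measure.prod_prod, Real.volume_Icc,
    ← ENNReal.ofReal_mul (by linarith)]
  congr 1; ring

instance : IsProbabilityMeasure (volume : Measure (UnitAddTorus (Fin 2))) where
  measure_univ := by
    rw [← Set.pi_univ Set.univ, volume_pi_pi]
    simp

theorem measureReal_setOf_add (p : UnitAddTorus (Fin 2) → Prop) (g : UnitAddTorus (Fin 2)) :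
    (volume : Measure (UnitAddTorus (Fin 2))).real {z | p (z + g)} =
      (volume : Measure (UnitAddTorus (Fin 2))).real {z | p z} := by
  have := measure_preimage_add_right (volume : Measure (UnitAddTorus (Fin 2))) g {z | p z}
  rw [measureReal_def, measureReal_def, ← this]
  rfl

theorem measureReal_sub_le_of_subset_union {α : Type*} [MeasurableSpace α] {μ : Measure α}
    [IsFiniteMeasure μ] {A B D : Set α} (h : A ⊆ B ∪ D) : μ.real A - μ.real B ≤ μ.real D := by
  have := (measureReal_mono (μ := μ) h).trans (measureReal_union_le B D)
  linarith

/-- Translating a set nearly invariant in the first direction and a set nearly invariant in the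
second one changes the correlation little. -/
theorem abs_translate_sub_le {h : ℝ × ℝ →+ UnitAddTorus (Fin 2)}
    {P E : Set (UnitAddTorus (Fin 2))} {S e₁ e₂ : ℝ}
    (h₁ : ∀ a : ℝ, |a| ≤ S → volume.real {z | z ∈ P ∧ z + h (a, 0) ∉ P} ≤ e₁)
    (h₂ : ∀ b : ℝ, |b| ≤ S → volume.real {z | z ∈ E ∧ z + h (0, b) ∉ E} ≤ e₂)
    {w : ℝ × ℝ} (hw : w ∈ square S) :
    |volume.real {z | z ∈ E ∧ z + h w ∈ P} - volume.real (P ∩ E)| ≤ e₁ + e₂ := by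
  obtain ⟨ha, hb⟩ := mem_square.1 hw
  have hw' : ∀ z, z + h w = z + h (0, w.2) + h (w.1, 0) := by
    intro z; rw [add_assoc, ← map_add]; simp
  have hwn : ∀ z, z + h w + h (-w.1, 0) = z + h (0, w.2) := by
    intro z; rw [add_assoc, ← map_add]; congr 2; ext <;> simp
  have hn0 : ∀ z, z + h (0, w.2) + h (0, -w.2) = z := by
    intro z; rw [add_assoc, ← map_add, Prod.mk_add_mk, add_neg_cancel, add_zero,
      ← Prod.zero_eq_mk, map_zero, add_zero]
  -- Halfway point: dropping the first component of `w` costs `e₁`; then, after a Haar translation,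
  -- moving `E` instead of `P` along the second axis costs `e₂`.
  set X := volume.real {z | z ∈ E ∧ z + h (0, w.2) ∈ P}
  have k1 : volume.real {z | z ∈ E ∧ z + h w ∈ P} - X ≤ e₁ := by
    refine (measureReal_sub_le_of_subset_union (D := {z | z + h w ∈ P ∧
      z + h w + h (-w.1, 0) ∉ P}) fun z hz => ?_).trans ?_
    · by_cases hz' : z + h (0, w.2) ∈ P
      · exact Or.inl ⟨hz.1, hz'⟩
      · exact Or.inr ⟨hz.2, by rwa [hwn]⟩
    · rw [measureReal_setOf_add (fun z => z ∈ P ∧ z + h (-w.1, 0) ∉ P)]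
      exact h₁ _ (by rwa [abs_neg])
  have k2 : X - volume.real {z | z ∈ E ∧ z + h w ∈ P} ≤ e₁ := by
    refine (measureReal_sub_le_of_subset_union (D := {z | z + h (0, w.2) ∈ P ∧
      z + h (0, w.2) + h (w.1, 0) ∉ P}) fun z hz => ?_).trans ?_
    · by_cases hz' : z + h w ∈ P
      · exact Or.inl ⟨hz.1, hz'⟩
      · exact Or.inr ⟨hz.2, by rwa [← hw']⟩
    · rw [measureReal_setOf_add (fun z => z ∈ P ∧ z + h (w.1, 0) ∉ P)]
      exact h₁ _ ha
  have k3 : X - volume.real (P ∩ E) ≤ e₂ := by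
    have e : volume.real (P ∩ E) =
        volume.real {z | z + h (0, w.2) ∈ P ∧ z + h (0, w.2) ∈ E} :=
      (measureReal_setOf_add (fun z => z ∈ P ∧ z ∈ E) _).symm
    rw [e]
    refine (measureReal_sub_le_of_subset_union (D := {z | z ∈ E ∧ z + h (0, w.2) ∉ E})
      fun z hz => ?_).trans (h₂ _ hb)
    by_cases hz' : z + h (0, w.2) ∈ E
    · exact Or.inl ⟨hz.2, hz'⟩
    · exact Or.inr ⟨hz.1, hz'⟩
  have k4 : volume.real (P ∩ E) - X ≤ e₂ := by
    have e : volume.real (P ∩ E) =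
        volume.real {z | z + h (0, w.2) ∈ P ∧ z + h (0, w.2) ∈ E} :=
      (measureReal_setOf_add (fun z => z ∈ P ∧ z ∈ E) _).symm
    rw [e]
    refine (measureReal_sub_le_of_subset_union (D := {z | z + h (0, w.2) ∈ E ∧
      z + h (0, w.2) + h (0, -w.2) ∉ E}) fun z hz => ?_).trans ?_
    · by_cases hz' : z ∈ E
      · exact Or.inl ⟨hz', hz.1⟩
      · exact Or.inr ⟨hz.2, by rwa [hn0]⟩
    · rw [measureReal_setOf_add (fun z => z ∈ E ∧ z + h (0, -w.2) ∉ E)]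
      exact h₂ _ (by rwa [abs_neg])
  rw [abs_le]
  constructor <;> linarith

/-! ### Averaging over translates. -/

namespace TorusChart
variable {h : ℝ × ℝ →+ UnitAddTorus (Fin 2)} (c : TorusChart h)
include c

theorem volume_domain_inter {A : Set (UnitAddTorus (Fin 2))} (hA : MeasurableSet A)
    (y : UnitAddTorus (Fin 2)) :
    volume {w | w ∈ c.domain ∧ y + h w ∈ A} = (ENNReal.ofReal c.density)⁻¹ * volume A := by
  have hA' : MeasurableSet ((fun z => y + z) ⁻¹' A) := (measurable_const_add y) hA
  have h1 := congrArg (fun μ => μ ((fun z => y + z) ⁻¹' A)) c.map_restrict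
  simp only [Measure.smul_apply, smul_eq_mul, measure_preimage_add] at h1
  rw [Measure.map_apply c.continuous.measurable hA',
    Measure.restrict_apply (c.continuous.measurable hA')] at h1
  rw [← h1]
  congr 1
  ext w
  simp [and_comm]

theorem volume_domain : volume c.domain = (ENNReal.ofReal c.density)⁻¹ := by
  simpa using c.volume_domain_inter MeasurableSet.univ 0

theorem density_ne_zero : ENNReal.ofReal c.density ≠ 0 := by
  simpa using c.density_pos

theorem inv_density_ne_zero : (ENNReal.ofReal c.density)⁻¹ ≠ 0 :=
  ENNReal.inv_ne_zero.2 ENNReal.ofReal_ne_top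

theorem inv_density_ne_top : (ENNReal.ofReal c.density)⁻¹ ≠ ⊤ :=
  ENNReal.inv_ne_top.2 c.density_ne_zero

theorem injOn_of_small {E : Set (ℝ × ℝ)} (hE' : ∀ w ∈ E, |w.1| < c.radius ∧ |w.2| < c.radius)
    (ζ : UnitAddTorus (Fin 2)) : Set.InjOn (fun w => ζ + h w) E := by
  intro v hv w hw hvw
  have h1 : h (c.center + v) = h (c.center + w) := by
    rw [map_add, map_add, add_left_cancel hvw]
  exact add_left_cancel (c.injOn (c.center_add_mem v (hE' v hv).1 (hE' v hv).2)
    (c.center_add_mem w (hE' w hw).1 (hE' w hw).2) h1)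

theorem measurableSet_image {E : Set (ℝ × ℝ)} (hE : MeasurableSet E)
    (hE' : ∀ w ∈ E, |w.1| < c.radius ∧ |w.2| < c.radius) (ζ : UnitAddTorus (Fin 2)) :
    MeasurableSet ((fun w => ζ + h w) '' E) :=
  hE.image_of_continuousOn_injOn (continuous_const.add c.continuous).continuousOn
    (c.injOn_of_small hE' ζ)

theorem volume_image {E : Set (ℝ × ℝ)} (hE : MeasurableSet E)
    (hE' : ∀ w ∈ E, |w.1| < c.radius ∧ |w.2| < c.radius) (ζ : UnitAddTorus (Fin 2)) :
    volume ((fun w => ζ + h w) '' E) = ENNReal.ofReal c.density * volume E := by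
  -- This base point moves `E` to `center + E`, which lies in the domain.
  have h1 := c.volume_domain_inter (c.measurableSet_image hE hE' ζ) (ζ - h c.center)
  have h2 : {w | w ∈ c.domain ∧ ζ - h c.center + h w ∈ (fun w => ζ + h w) '' E} =
      (fun w => -c.center + w) ⁻¹' E := by
    ext w
    simp only [Set.mem_ofPred_eq, Set.mem_image, Set.mem_preimage]
    constructor
    · rintro ⟨hw, e, he, hew⟩
      have h3 : h (c.center + e) = h w := by
        rw [map_add]
        have : h e = -h c.center + h w := by
          apply add_left_cancel (a := ζ); rw [hew]; abel
        rw [this]; abel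
      have h4 := c.injOn (c.center_add_mem e (hE' e he).1 (hE' e he).2) hw h3
      rw [← h4]; simpa using he
    · intro hw
      have h3 := c.center_add_mem _ (hE' _ hw).1 (hE' _ hw).2
      rw [add_neg_cancel_left] at h3
      refine ⟨h3, _, hw, ?_⟩
      rw [map_add, map_neg]; abel
  rw [h2, measure_preimage_add] at h1
  rw [h1, ← mul_assoc, ENNReal.mul_inv_cancel c.density_ne_zero ENNReal.ofReal_ne_top, one_mul]

/-- By Tonelli: for fixed `w`, the translates `z + h (w + w')` with `w'` in the domain sweep the
torus uniformly, whatever the base point. -/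
theorem lintegral_translates {P : Set (UnitAddTorus (Fin 2))} (hP : MeasurableSet P)
    (z : UnitAddTorus (Fin 2)) (A : Set (ℝ × ℝ)) :
    ∫⁻ w' in c.domain, volume {w | w ∈ A ∧ z + h (w + w') ∈ P} =
      (ENNReal.ofReal c.density)⁻¹ * volume P * volume A := by
  have hm : MeasurableSet {p : (ℝ × ℝ) × (ℝ × ℝ) | z + h (p.2 + p.1) ∈ P} :=
    (continuous_const.add (c.continuous.comp
      (continuous_snd.add continuous_fst))).measurable hP
  have e1 : ∀ w', volume {w | w ∈ A ∧ z + h (w + w') ∈ P} =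
      (volume.restrict A) (Prod.mk w' ⁻¹' {p : (ℝ × ℝ) × (ℝ × ℝ) | z + h (p.2 + p.1) ∈ P}) := by
    intro w'
    rw [Measure.restrict_apply (measurable_prodMk_left hm)]
    congr 1; ext w; simp [and_comm]
  have e2 : ∀ w, (volume.restrict c.domain)
      ((fun w' => (w', w)) ⁻¹' {p : (ℝ × ℝ) × (ℝ × ℝ) | z + h (p.2 + p.1) ∈ P}) =
      (ENNReal.ofReal c.density)⁻¹ * volume P := by
    intro w
    rw [Measure.restrict_apply (measurable_prodMk_right hm),
      ← c.volume_domain_inter hP (z + h w)]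
    congr 1; ext w'; simp [and_comm, add_assoc]
  simp_rw [e1]
  rw [← Measure.prod_apply hm, Measure.prod_apply_symm hm]
  simp_rw [e2]
  rw [lintegral_const, Measure.restrict_apply_univ]

/-- Enlarging the square by `bound` absorbs a shift by any `w'` in the domain; averaging over `w'`
then makes the count exact. -/
theorem volume_visits_le {P : Set (UnitAddTorus (Fin 2))} (hP : MeasurableSet P)
    (z : UnitAddTorus (Fin 2)) {S : ℝ} :
    volume {w | w ∈ square S ∧ z + h w ∈ P} ≤ volume (square (S + c.bound)) * volume P := by
  have h1 := c.lintegral_translates hP z (square (S + c.bound))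
  have h2 : ∫⁻ _ in c.domain, volume {w | w ∈ square S ∧ z + h w ∈ P} ≤
      ∫⁻ w' in c.domain, volume {w | w ∈ square (S + c.bound) ∧ z + h (w + w') ∈ P} := by
    refine setLIntegral_mono' c.measurableSet_domain fun w' hw' => ?_
    rw [← measure_preimage_add_right volume w' {w | w ∈ square S ∧ z + h w ∈ P}]
    refine measure_mono fun w hw => ⟨?_, hw.2⟩
    have hw1 := mem_square.1 hw.1
    have hb := c.abs_coord_le w' hw'
    simp only [Prod.fst_add, Prod.snd_add, abs_le] at hw1 hb
    rw [mem_square, abs_le, abs_le]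
    refine ⟨⟨?_, ?_⟩, ?_, ?_⟩ <;> linarith
  rw [h1, lintegral_const, Measure.restrict_apply_univ, c.volume_domain, mul_comm, mul_assoc] at h2
  rw [mul_comm (volume _)]
  exact (ENNReal.mul_le_mul_iff_right c.inv_density_ne_zero c.inv_density_ne_top).1 h2

theorem le_volume_visits {P : Set (UnitAddTorus (Fin 2))} (hP : MeasurableSet P)
    (z : UnitAddTorus (Fin 2)) {S : ℝ} :
    volume (square (S - c.bound)) * volume P ≤ volume {w | w ∈ square S ∧ z + h w ∈ P} := by
  have h1 := c.lintegral_translates hP z (square (S - c.bound))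
  have h2 : ∫⁻ w' in c.domain, volume {w | w ∈ square (S - c.bound) ∧ z + h (w + w') ∈ P} ≤
      ∫⁻ _ in c.domain, volume {w | w ∈ square S ∧ z + h w ∈ P} := by
    refine setLIntegral_mono' c.measurableSet_domain fun w' hw' => ?_
    rw [← measure_preimage_add_right volume w' {w | w ∈ square S ∧ z + h w ∈ P}]
    refine measure_mono fun w hw => ⟨?_, hw.2⟩
    have hw1 := mem_square.1 hw.1
    have hb := c.abs_coord_le w' hw'
    simp only [abs_le] at hw1 hb
    simp only [mem_square, Prod.fst_add, Prod.snd_add, abs_le]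
    refine ⟨⟨?_, ?_⟩, ?_, ?_⟩ <;> linarith
  rw [h1, lintegral_const, Measure.restrict_apply_univ, c.volume_domain,
    mul_comm (volume {w | w ∈ square S ∧ z + h w ∈ P}), mul_assoc] at h2
  rw [mul_comm (volume (square _))]
  exact (ENNReal.mul_le_mul_iff_right c.inv_density_ne_zero c.inv_density_ne_top).1 h2

theorem lintegral_square_eq {P E : Set (UnitAddTorus (Fin 2))} (hP : MeasurableSet P)
    (S : ℝ) :
    ∫⁻ w in square S, volume {z | z ∈ E ∧ z + h w ∈ P} =
      ∫⁻ z in E, volume {w | w ∈ square S ∧ z + h w ∈ P} := by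
  have hm : MeasurableSet {p : (ℝ × ℝ) × UnitAddTorus (Fin 2) | p.2 + h p.1 ∈ P} :=
    (continuous_snd.add (c.continuous.comp continuous_fst)).measurable hP
  have e1 : ∀ w, volume {z | z ∈ E ∧ z + h w ∈ P} =
      (volume.restrict E) (Prod.mk w ⁻¹' {p | p.2 + h p.1 ∈ P}) := by
    intro w
    rw [Measure.restrict_apply (measurable_prodMk_left hm)]
    congr 1; ext z; simp [and_comm]
  have e2 : ∀ z, volume {w | w ∈ square S ∧ z + h w ∈ P} =
      (volume.restrict (square S)) ((fun w => (w, z)) ⁻¹' {p | p.2 + h p.1 ∈ P}) := by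
    intro z
    rw [Measure.restrict_apply (measurable_prodMk_right hm)]
    congr 1; ext w; simp [and_comm]
  simp_rw [e1, e2]
  rw [← Measure.prod_apply hm, Measure.prod_apply_symm hm]

/-- A set nearly invariant under long translations in the first direction is nearly independent of
a set nearly invariant under long translations in the second one. -/
theorem abs_correlation_le {P E : Set (UnitAddTorus (Fin 2))} (hP : MeasurableSet P)
    {S e₁ e₂ : ℝ} (hS : c.bound ≤ S)
    (h₁ : ∀ a : ℝ, |a| ≤ S → volume.real {z | z ∈ P ∧ z + h (a, 0) ∉ P} ≤ e₁)
    (h₂ : ∀ b : ℝ, |b| ≤ S → volume.real {z | z ∈ E ∧ z + h (0, b) ∉ E} ≤ e₂) :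
    |volume.real (P ∩ E) - volume.real P * volume.real E| ≤
      e₁ + e₂ + 3 * c.bound * volume.real P / S := by
  have hC := c.bound_pos
  have hS0 : 0 < S := hC.trans_le hS
  set x := volume.real (P ∩ E)
  set y := volume.real P * volume.real E
  have hy0 : 0 ≤ y := mul_nonneg measureReal_nonneg measureReal_nonneg
  have hyP : y ≤ volume.real P := mul_le_of_le_one_right measureReal_nonneg measureReal_le_one
  have hPE : volume P * volume E = ENNReal.ofReal y := by
    rw [ENNReal.ofReal_mul measureReal_nonneg, ofReal_measureReal, ofReal_measureReal]
  have he0 : 0 ≤ e₁ + e₂ :=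
    (abs_nonneg _).trans (abs_translate_sub_le h₁ h₂ (w := 0)
      (mem_square.2 ⟨by simpa using hS0.le, by simpa using hS0.le⟩))
  -- These bounds are integrated over the square. After exchanging the integrals, the middle term is
  -- the area times `y`, up to a boundary layer of width `bound`.
  have hpt : ∀ w ∈ square S, ENNReal.ofReal (x - (e₁ + e₂)) ≤ volume {z | z ∈ E ∧ z + h w ∈ P} ∧
      volume {z | z ∈ E ∧ z + h w ∈ P} ≤ ENNReal.ofReal (x + (e₁ + e₂)) := by
    intro w hw
    have := abs_le.1 (abs_translate_sub_le h₁ h₂ hw)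
    rw [← ofReal_measureReal (μ := volume) (s := {z | z ∈ E ∧ z + h w ∈ P})]
    constructor <;> apply ENNReal.ofReal_le_ofReal <;> linarith
  have hx0 : 0 ≤ x := measureReal_nonneg
  have hsq : (0 : ℝ) < (2 * S) ^ 2 := by positivity
  have up : (x - (e₁ + e₂)) * (2 * S) ^ 2 ≤ (2 * (S + c.bound)) ^ 2 * y := by
    rw [← ENNReal.ofReal_le_ofReal_iff (by positivity), ENNReal.ofReal_mul' (by positivity),
      ENNReal.ofReal_mul (by positivity), ← volume_square hS0.le, ← volume_square (by linarith),
      ← hPE, ← setLIntegral_const]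
    refine (setLIntegral_mono' (measurableSet_square S) fun w hw => (hpt w hw).1).trans ?_
    rw [c.lintegral_square_eq hP, ← mul_assoc, ← setLIntegral_const]
    exact lintegral_mono fun z => c.volume_visits_le hP z
  have lo : (2 * (S - c.bound)) ^ 2 * y ≤ (x + (e₁ + e₂)) * (2 * S) ^ 2 := by
    rw [← ENNReal.ofReal_le_ofReal_iff (by positivity), ENNReal.ofReal_mul' hy0,
      ENNReal.ofReal_mul' hsq.le, ← volume_square hS0.le, ← volume_square (by linarith),
      ← hPE, ← setLIntegral_const (square S)]
    refine le_trans ?_ (setLIntegral_mono' (measurableSet_square S) fun w hw => (hpt w hw).2)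
    rw [c.lintegral_square_eq hP, ← mul_assoc, ← setLIntegral_const]
    exact lintegral_mono fun z => c.le_volume_visits hP z
  clear_value x y
  have hp0 : 0 ≤ volume.real P := measureReal_nonneg
  have hg : 3 * c.bound * y ≤ 3 * c.bound * volume.real P := by gcongr
  rw [abs_le, ← sub_le_iff_le_add', le_div_iff₀ hS0, ← neg_le_neg_iff, neg_neg,
    ← sub_le_iff_le_add', le_div_iff₀ hS0]
  -- The constant `3` comes from `2 S C + C² ≤ 3 S C` for `C = bound ≤ S`.
  have e1 : c.bound * c.bound * y ≤ S * c.bound * y := by gcongr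
  constructor
  · refine le_trans ?_ hg
    refine le_of_mul_le_mul_right (a := 4 * S) ?_ (by positivity)
    nlinarith [mul_nonneg (mul_nonneg hC.le hC.le) hy0]
  · refine le_trans ?_ hg
    refine le_of_mul_le_mul_right (a := 4 * S) ?_ (by positivity)
    nlinarith

end TorusChart

/-! ### Targets and their returns -/

/-- The points of the line with absolute value in `[α r, r)`. -/
def band (α r : ℝ) : Set ℝ := {x | α * r ≤ |x| ∧ |x| < r}

theorem measurableSet_band (α r : ℝ) : MeasurableSet (band α r) :=
  (measurableSet_le measurable_const measurable_norm).inter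
    (measurableSet_lt measurable_norm measurable_const)

theorem volume_band {α r : ℝ} (hα : 0 ≤ α) (hα1 : α ≤ 1) (hr : 0 < r) :
    volume (band α r) = ENNReal.ofReal (2 * (1 - α) * r) := by
  have h1 : band α r = Set.Ioo (-r) r \ Set.Ioo (-(α * r)) (α * r) := by
    ext x
    simp only [band, Set.mem_sdiff, Set.mem_Ioo, ← abs_lt, not_lt, Set.mem_ofPred_eq]
    exact and_comm
  have h2 : α * r ≤ r := mul_le_of_le_one_left hr.le hα1
  rw [h1, measure_sdiff (Set.Ioo_subset_Ioo (by linarith) h2) measurableSet_Ioo.nullMeasurableSet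
    (by simp), Real.volume_Ioo, Real.volume_Ioo, ← ENNReal.ofReal_sub _ (by nlinarith)]
  congr 1; ring

/-- A shift by `δ` leaves the band only across one of its four ends `±r`, `±α r`, from within `|δ|`
of it. -/
theorem volume_band_diff_le {α r : ℝ} (hα : 0 ≤ α) (hr : 0 < r) (δ : ℝ) :
    volume {x | x ∈ band α r ∧ x + δ ∉ band α r} ≤ ENNReal.ofReal (4 * |δ|) := by
  have hsub : {x | x ∈ band α r ∧ x + δ ∉ band α r} ⊆
      (Set.Icc (r - |δ|) r ∪ Set.Icc (-r) (-r + |δ|)) ∪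
      (Set.Icc (α * r) (α * r + |δ|) ∪ Set.Icc (-(α * r) - |δ|) (-(α * r))) := by
    rintro x ⟨⟨h1, h2⟩, h3⟩
    have h3' : x + δ ∈ band α r ↔ α * r ≤ |x + δ| ∧ |x + δ| < r := Iff.rfl
    rw [h3', not_and_or, not_le, not_lt] at h3
    have hαr : 0 ≤ α * r := by positivity
    have t1 := abs_add_le x δ
    have t2 : |x| ≤ |x + δ| + |δ| := by
      have := abs_add_le (x + δ) (-δ); rw [abs_neg, add_neg_cancel_right] at this; exact this
    simp only [Set.mem_union, Set.mem_Icc]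
    rcases h3 with h3 | h3 <;> rcases abs_cases x with ⟨hx, _⟩ | ⟨hx, _⟩
    · right; left; constructor <;> linarith
    · right; right; constructor <;> linarith
    · left; left; constructor <;> linarith
    · left; right; constructor <;> linarith
  have hd := abs_nonneg δ
  have e : ENNReal.ofReal (4 * |δ|) = (ENNReal.ofReal |δ| + ENNReal.ofReal |δ|) +
      (ENNReal.ofReal |δ| + ENNReal.ofReal |δ|) := by
    rw [← ENNReal.ofReal_add hd hd, ← ENNReal.ofReal_add (by linarith) (by linarith)]
    congr 1; ring
  rw [e]
  refine (measure_mono hsub).trans ((measure_union_le _ _).trans (add_le_add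
    ((measure_union_le _ _).trans (add_le_add ?_ ?_))
    ((measure_union_le _ _).trans (add_le_add ?_ ?_)))) <;>
  · rw [Real.volume_Icc]
    apply ENNReal.ofReal_le_ofReal
    linarith

/-- A set of reals any two points of which are at distance at most `d` or more than `l`. -/
theorem volume_le_of_clusters {V : Set ℝ} {r l d : ℝ} (hr : 0 ≤ r) (hl : 0 < l)
    (hV : ∀ x ∈ V, |x| ≤ r) (h : ∀ x ∈ V, ∀ y ∈ V, |x - y| ≤ l → |x - y| ≤ d) :
    volume V ≤ ENNReal.ofReal ((2 * r / l + 1) * d) := by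
  -- Cut into cells of length `l`: each meets `V` in a set of diameter at most `d`.
  have hsub : V ⊆ ⋃ i ∈ Finset.range (⌊2 * r / l⌋₊ + 1), {x | x ∈ V ∧ ⌊(x + r) / l⌋₊ = i} := by
    intro x hx
    simp only [Set.mem_iUnion, Finset.mem_range, exists_prop]
    refine ⟨_, ?_, hx, rfl⟩
    rw [Nat.lt_succ_iff]
    apply Nat.floor_le_floor
    have := (abs_le.1 (hV x hx)).2
    gcongr; linarith
  have hpiece : ∀ i, volume {x | x ∈ V ∧ ⌊(x + r) / l⌋₊ = i} ≤ ENNReal.ofReal d := by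
    intro i
    refine (Real.volume_le_diam _).trans (Metric.ediam_le fun x hx y hy => ?_)
    rw [edist_dist, Real.dist_eq]
    apply ENNReal.ofReal_le_ofReal
    refine h x hx.1 y hy.1 ?_
    have hfl : ∀ x, x ∈ V → ⌊(x + r) / l⌋₊ = i → i * l ≤ x + r ∧ x + r < (i + 1) * l := by
      intro x hx hi
      have h0 : 0 ≤ (x + r) / l := div_nonneg (by linarith [(abs_le.1 (hV x hx)).1]) hl.le
      have := (Nat.floor_eq_iff h0).1 hi
      exact ⟨(le_div_iff₀ hl).1 this.1, (div_lt_iff₀ hl).1 this.2⟩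
    have hx' := hfl x hx.1 hx.2
    have hy' := hfl y hy.1 hy.2
    rw [abs_le]
    constructor <;> nlinarith
  refine (measure_mono hsub).trans ((measure_biUnion_finset_le _ _).trans
    ((Finset.sum_le_sum fun i _ => hpiece i).trans ?_))
  rw [Finset.sum_const, Finset.card_range, nsmul_eq_mul, ENNReal.ofReal_mul (by positivity)]
  gcongr
  rw [← ENNReal.ofReal_natCast]
  apply ENNReal.ofReal_le_ofReal
  push_cast
  gcongr
  exact Nat.floor_le (by positivity)

/-- The box of half-side `r` around `ζ`, in the coordinates given by `h`, without the smaller box of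
half-sides `α r` and `r`. -/
def target (h : ℝ × ℝ →+ UnitAddTorus (Fin 2)) (ζ : UnitAddTorus (Fin 2)) (α r : ℝ) :
    Set (UnitAddTorus (Fin 2)) :=
  (fun w => ζ + h w) '' (band α r ×ˢ band 0 r)

namespace TorusChart
variable {h : ℝ × ℝ →+ UnitAddTorus (Fin 2)} (c : TorusChart h) {ζ : UnitAddTorus (Fin 2)}
  {α r : ℝ}
include c

theorem small_of_mem_band (hrc : r ≤ c.radius) :
    ∀ w ∈ band α r ×ˢ band 0 r, |w.1| < c.radius ∧ |w.2| < c.radius :=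
  fun _ hw => ⟨hw.1.2.trans_le hrc, hw.2.2.trans_le hrc⟩

theorem measurableSet_target (hrc : r ≤ c.radius) : MeasurableSet (target h ζ α r) :=
  c.measurableSet_image ((measurableSet_band _ _).prod (measurableSet_band _ _))
    (c.small_of_mem_band hrc) ζ

theorem measureReal_image_le {V : Set (ℝ × ℝ)} (hV : MeasurableSet V)
    (hV' : ∀ w ∈ V, |w.1| < c.radius ∧ |w.2| < c.radius) {v : ℝ} (hv : 0 ≤ v)
    (hVv : volume V ≤ ENNReal.ofReal v) :
    (volume : Measure (UnitAddTorus (Fin 2))).real ((fun w => ζ + h w) '' V) ≤ c.density * v := by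
  rw [measureReal_def, c.volume_image hV hV']
  refine ENNReal.toReal_le_of_le_ofReal (mul_nonneg c.density_pos.le hv) ?_
  rw [ENNReal.ofReal_mul c.density_pos.le]
  gcongr

theorem measureReal_target (hα : 0 ≤ α) (hα1 : α ≤ 1) (hr : 0 < r) (hrc : r ≤ c.radius) :
    volume.real (target h ζ α r) = c.density * (4 * (1 - α) * r ^ 2) := by
  rw [measureReal_def, target, c.volume_image ((measurableSet_band _ _).prod (measurableSet_band _ _))
    (c.small_of_mem_band hrc), Measure.volume_eq_prod, Measure.prod_prod, volume_band hα hα1 hr,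
    volume_band le_rfl zero_le_one hr]
  have h1 : 0 ≤ 1 - α := by linarith
  rw [ENNReal.toReal_mul, ENNReal.toReal_mul, ENNReal.toReal_ofReal c.density_pos.le,
    ENNReal.toReal_ofReal (by positivity), ENNReal.toReal_ofReal (by linarith)]
  ring

theorem measureReal_shift_fst_le (hα : 0 ≤ α) (hr : 0 < r) (hrc : r ≤ c.radius) (δ : ℝ) :
    volume.real {z | z ∈ target h ζ α r ∧ z + h (δ, 0) ∉ target h ζ α r} ≤
      c.density * (8 * r * |δ|) := by
  have hm : MeasurableSet {x | x ∈ band α r ∧ x + δ ∉ band α r} :=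
    (measurableSet_band α r).inter ((measurable_add_const δ) (measurableSet_band α r)).compl
  have hsub : {z | z ∈ target h ζ α r ∧ z + h (δ, 0) ∉ target h ζ α r} ⊆
      (fun w => ζ + h w) '' ({x | x ∈ band α r ∧ x + δ ∉ band α r} ×ˢ band 0 r) := by
    rintro _ ⟨⟨w, hw, rfl⟩, h2⟩
    refine ⟨w, ⟨⟨hw.1, fun h3 => h2 ⟨w + (δ, 0), ⟨h3, by simpa using hw.2⟩, ?_⟩⟩, hw.2⟩, rfl⟩
    simp only [map_add, add_assoc]
  refine (measureReal_mono hsub).trans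
    (c.measureReal_image_le (hm.prod (measurableSet_band _ _))
    (fun w hw => c.small_of_mem_band hrc w ⟨hw.1.1, hw.2⟩) (by positivity) ?_)
  rw [Measure.volume_eq_prod, Measure.prod_prod, volume_band le_rfl zero_le_one hr,
    show 8 * r * |δ| = (4 * |δ|) * (2 * (1 - 0) * r) by ring,
    ENNReal.ofReal_mul (p := 4 * |δ|) (by positivity)]
  exact mul_le_mul' (volume_band_diff_le hα hr δ) le_rfl

theorem measureReal_shift_snd_le (hα : 0 ≤ α) (hα1 : α ≤ 1) (hr : 0 < r) (hrc : r ≤ c.radius)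
    (δ : ℝ) :
    volume.real {z | z ∈ target h ζ α r ∧ z + h (0, δ) ∉ target h ζ α r} ≤
      c.density * (8 * r * |δ|) := by
  have hm : MeasurableSet {x | x ∈ band 0 r ∧ x + δ ∉ band 0 r} :=
    (measurableSet_band 0 r).inter ((measurable_add_const δ) (measurableSet_band 0 r)).compl
  have hsub : {z | z ∈ target h ζ α r ∧ z + h (0, δ) ∉ target h ζ α r} ⊆
      (fun w => ζ + h w) '' (band α r ×ˢ {x | x ∈ band 0 r ∧ x + δ ∉ band 0 r}) := by
    rintro _ ⟨⟨w, hw, rfl⟩, h2⟩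
    refine ⟨w, ⟨hw.1, ⟨hw.2, fun h3 => h2 ⟨w + (0, δ), ⟨by simpa using hw.1, h3⟩, ?_⟩⟩⟩, rfl⟩
    simp only [map_add, add_assoc]
  refine (measureReal_mono hsub).trans
    (c.measureReal_image_le ((measurableSet_band _ _).prod hm)
    (fun w hw => c.small_of_mem_band hrc w ⟨hw.1, hw.2.1⟩) (by positivity) ?_)
  rw [Measure.volume_eq_prod, Measure.prod_prod, volume_band hα hα1 hr,
    show 8 * r * |δ| = (2 * r) * (4 * |δ|) by ring,
    ENNReal.ofReal_mul (p := 2 * r) (by positivity)]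
  exact mul_le_mul' (ENNReal.ofReal_le_ofReal (by nlinarith)) (volume_band_diff_le le_rfl hr δ)

theorem exists_pos_forall_small (y : UnitAddTorus (Fin 2)) :
    ∃ ε > 0, ∀ w : ℝ × ℝ, |w.1| < ε → |w.2| < ε → h w = y → y = 0 ∧ w = 0 := by
  by_cases hy : y = 0
  · refine ⟨c.radius, c.radius_pos, fun w h1 h2 hw => ⟨hy, ?_⟩⟩
    exact c.eq_zero_of_map_eq_zero h1 h2 (hw.trans hy)
  · have ho : IsOpen {w | h w ≠ y} := isOpen_ne_fun c.continuous continuous_const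
    obtain ⟨ε, hε, hb⟩ := Metric.isOpen_iff.1 ho 0 (by simpa using Ne.symm hy)
    refine ⟨ε, hε, fun w h1 h2 hw => absurd hw (hb ?_)⟩
    rw [Metric.mem_ball, dist_zero_right, Prod.norm_def]
    exact max_lt h1 h2

end TorusChart

theorem target_subset (h : ℝ × ℝ →+ UnitAddTorus (Fin 2)) (ζ : UnitAddTorus (Fin 2))
    (α r : ℝ) : target h ζ α r ⊆ target h ζ 0 r := by
  rintro _ ⟨w, hw, rfl⟩
  exact ⟨w, ⟨⟨by simp, hw.1.2⟩, hw.2⟩, rfl⟩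

namespace IsHyperbolicPair
variable {h : ℝ × ℝ →+ UnitAddTorus (Fin 2)} {lam : ℝ}
  {T S : UnitAddTorus (Fin 2) →+ UnitAddTorus (Fin 2)} (H : IsHyperbolicPair h lam T S)
include H

theorem iterate_add_chart (j : ℕ) (ζ : UnitAddTorus (Fin 2)) (w : ℝ × ℝ) :
    T^[j] (ζ + h w) = T^[j] ζ + h (lam ^ j * w.1, lam⁻¹ ^ j * w.2) := by
  rw [iterate_map_add, H.pow_chart]

/-- For fixed `j`, arbitrarily small returns force `T^j ζ = ζ`. Then the first coordinate, at least
`α r`, is multiplied by `|λ|^j` and reaches `r`. -/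
theorem eventually_no_return (c : TorusChart h) {ζ : UnitAddTorus (Fin 2)} {α : ℝ} {j : ℕ}
    (hj : T^[j] ζ = ζ → 1 ≤ α * |lam| ^ j) :
    ∀ᶠ r in 𝓝 (0 : ℝ), ∀ z ∈ target h ζ α r, T^[j] z ∉ target h ζ α r := by
  obtain ⟨ε, hε, hsmall⟩ := c.exists_pos_forall_small (T^[j] ζ - ζ)
  have hl : ∀ x : ℝ, ∀ᶠ r in 𝓝 (0 : ℝ), r * (1 + |x| ^ j) < ε := by
    intro x
    have : Tendsto (fun r : ℝ => r * (1 + |x| ^ j)) (𝓝 0) (𝓝 (0 * (1 + |x| ^ j))) :=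
      tendsto_id.mul_const _
    rw [zero_mul] at this
    exact this.eventually (gt_mem_nhds hε)
  filter_upwards [hl lam, hl lam⁻¹] with r h1 h2
  rintro _ ⟨w, hw, rfl⟩ ⟨w', hw', he⟩
  have he' : h (w' - (lam ^ j * w.1, lam⁻¹ ^ j * w.2)) = T^[j] ζ - ζ := by
    simp only [H.iterate_add_chart] at he
    rw [map_sub, sub_eq_sub_iff_add_eq_add, add_comm (h w'), he]
  have habs : ∀ x a b : ℝ, |a| < r → |b| < r → |a - x ^ j * b| ≤ r * (1 + |x| ^ j) := by
    intro x a b ha hb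
    refine (abs_sub _ _).trans ?_
    rw [abs_mul, abs_pow]
    have := mul_le_mul_of_nonneg_left hb.le (pow_nonneg (abs_nonneg x) j)
    linarith
  obtain ⟨hy, hw0⟩ := hsmall _ ((habs lam _ _ hw'.1.2 hw.1.2).trans_lt h1)
    ((habs lam⁻¹ _ _ hw'.2.2 hw.2.2).trans_lt h2) he'
  have h3 : w'.1 - lam ^ j * w.1 = 0 := congrArg Prod.fst hw0
  have h4 : |w'.1| = |lam| ^ j * |w.1| := by rw [sub_eq_zero.1 h3, abs_mul, abs_pow]
  have h5 := hj (sub_eq_zero.1 hy)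
  have hr : 0 < r := (abs_nonneg _).trans_lt hw.1.2
  have h6 := mul_le_mul_of_nonneg_left hw.1.1 (pow_nonneg (abs_nonneg lam) j)
  have h7 := hw'.1.2
  nlinarith

/-- Subtracting two returns gives a kernel vector `v`. If their first coordinates, expanded by
`λ^j`, differ by at most `η / (8 r)`, then `|v.1| |v.2| ≤ η / 2 + 8 r² < η`, so `v = 0` and these
coordinates differ by at most `2 r |λ|^{-j}`. One cluster yields the first term, their number the
second. -/
theorem measureReal_return_le (c : TorusChart h) {η : ℝ} (hη : 0 < η)
    (hker : ∀ w, h w = 0 → w ≠ 0 → η ≤ |w.1| * |w.2|) (ζ : UnitAddTorus (Fin 2)) {r : ℝ}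
    (hr : 0 < r) (hrc : r ≤ c.radius) (hrη : 16 * r ^ 2 < η) (j : ℕ) :
    volume.real {z | z ∈ target h ζ 0 r ∧ T^[j] z ∈ target h ζ 0 r} ≤
      c.density * (4 * r ^ 2 * |lam⁻¹| ^ j + 64 * r ^ 4 / η) := by
  set V : Set (ℝ × ℝ) := (band 0 r ×ˢ band 0 r) ∩ {w | T^[j] (ζ + h w) ∈ target h ζ 0 r}
  have hVm : MeasurableSet V := ((measurableSet_band _ _).prod (measurableSet_band _ _)).inter
    (((H.continuous.iterate j).comp (continuous_const.add c.continuous)).measurable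
      (c.measurableSet_target hrc))
  have hsub : {z | z ∈ target h ζ 0 r ∧ T^[j] z ∈ target h ζ 0 r} ⊆ (fun w => ζ + h w) '' V := by
    rintro _ ⟨⟨w, hw, rfl⟩, h2⟩
    exact ⟨w, ⟨hw, h2⟩, rfl⟩
  have hlj : 0 < |lam| ^ j := pow_pos (abs_pos.2 H.ne_zero) j
  have hlj' : |lam⁻¹| ^ j = (|lam| ^ j)⁻¹ := by rw [abs_inv, inv_pow]
  have hproj : volume (Prod.fst '' V) ≤
      ENNReal.ofReal ((2 * r / (η / (8 * r) * |lam⁻¹| ^ j) + 1) * (2 * r * |lam⁻¹| ^ j)) := by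
    rw [hlj']
    refine volume_le_of_clusters hr.le (by positivity) ?_ ?_
    · rintro _ ⟨w, hw, rfl⟩
      exact hw.1.1.2.le
    · rintro _ ⟨w, ⟨hw, x, hx, hwx⟩, rfl⟩ _ ⟨w', ⟨hw', x', hx', hwx'⟩, rfl⟩ hclose
      simp only [H.iterate_add_chart] at hwx hwx'
      rw [← div_eq_mul_inv, le_div_iff₀ hlj] at hclose ⊢
      have hcl : |lam ^ j * (w.1 - w'.1)| ≤ η / (8 * r) := by
        rwa [abs_mul, abs_pow, mul_comm]
      have hx1 : |x.1 - x'.1| ≤ 2 * r := by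
        have := abs_sub x.1 x'.1; linarith [hx.1.2, hx'.1.2]
      rw [mul_comm, ← abs_pow, ← abs_mul]
      set v : ℝ × ℝ := (lam ^ j * (w.1 - w'.1) - (x.1 - x'.1),
        lam⁻¹ ^ j * (w.2 - w'.2) - (x.2 - x'.2))
      have hv : h v = 0 := by
        have : v = ((lam ^ j * w.1, lam⁻¹ ^ j * w.2) - (lam ^ j * w'.1, lam⁻¹ ^ j * w'.2)) -
            (x - x') := by
          ext <;> simp [v, mul_sub]
        rw [this, map_sub, map_sub, map_sub]
        have e : ζ + h x - (ζ + h x') = T^[j] ζ + h (lam ^ j * w.1, lam⁻¹ ^ j * w.2) -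
          (T^[j] ζ + h (lam ^ j * w'.1, lam⁻¹ ^ j * w'.2)) := by rw [hwx, hwx']
        rw [add_sub_add_left_eq_sub, add_sub_add_left_eq_sub] at e
        rw [e, sub_self]
      by_cases hv0 : v = 0
      · have h1 : lam ^ j * (w.1 - w'.1) - (x.1 - x'.1) = 0 := congrArg Prod.fst hv0
        rwa [sub_eq_zero.1 h1]
      · exfalso
        have h1 := hker v hv hv0
        have hv1 : |v.1| ≤ η / (8 * r) + 2 * r := (abs_sub _ _).trans (add_le_add hcl hx1)
        have hv2 : |v.2| ≤ 4 * r := by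
          refine (abs_sub _ _).trans ?_
          rw [abs_mul, abs_pow]
          have a1 : |w.2 - w'.2| ≤ 2 * r := by
            have := abs_sub w.2 w'.2; linarith [hw.2.2, hw'.2.2]
          have a2 : |x.2 - x'.2| ≤ 2 * r := by
            have := abs_sub x.2 x'.2; linarith [hx.2.2, hx'.2.2]
          have a3 : |lam⁻¹| ^ j * |w.2 - w'.2| ≤ |w.2 - w'.2| :=
            mul_le_of_le_one_left (abs_nonneg _) (pow_le_one₀ (abs_nonneg _) H.inv_lt_one.le)
          linarith
        have h2 : |v.1| * |v.2| ≤ (η / (8 * r) + 2 * r) * (4 * r) :=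
          mul_le_mul hv1 hv2 (abs_nonneg _) (by positivity)
        have h3 : (η / (8 * r) + 2 * r) * (4 * r) = η / 2 + 8 * r ^ 2 := by field_simp; ring
        linarith
  refine (measureReal_mono hsub).trans (c.measureReal_image_le hVm
    (fun w hw => c.small_of_mem_band hrc w hw.1) (by positivity) ?_)
  have hVsub : V ⊆ (Prod.fst '' V) ×ˢ band 0 r := fun w hw => ⟨⟨w, hw, rfl⟩, hw.1.2⟩
  refine (measure_mono hVsub).trans ?_
  rw [Measure.volume_eq_prod, Measure.prod_prod, volume_band le_rfl zero_le_one hr]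
  refine (mul_le_mul' hproj le_rfl).trans ?_
  rw [← ENNReal.ofReal_mul (by positivity)]
  apply ENNReal.ofReal_le_ofReal
  rw [hlj']
  apply le_of_eq
  field_simp
  ring

end IsHyperbolicPair

/-! ### Hitting times of rare events -/

/-- The points whose first `l` iterates avoid `A`. -/
def avoiding {X : Type*} (T : X → X) (A : Set X) (l : ℕ) : Set X := {x | ∀ j < l, T^[j] x ∉ A}

theorem avoiding_anti {X : Type*} {T : X → X} {A : Set X} {l m : ℕ} (h : l ≤ m) :
    avoiding T A m ⊆ avoiding T A l :=
  fun _ hx j hj => hx j (hj.trans_le h)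

section avoiding
variable {X : Type*} [MeasurableSpace X] {μ : Measure X} {T : X → X} {A : Set X}

theorem measurableSet_avoiding (hT : Measurable T) (hA : MeasurableSet A) (l : ℕ) :
    MeasurableSet (avoiding T A l) := by
  have : avoiding T A l = ⋂ j ∈ Set.Iio l, (T^[j] ⁻¹' A)ᶜ := by
    ext x; simp [avoiding]
  rw [this]
  exact MeasurableSet.biInter (Set.to_countable _) fun j _ => ((hT.iterate j) hA).compl

variable [IsProbabilityMeasure μ]

theorem measureReal_avoiding_sub_le (hT : MeasurePreserving T μ μ) (hA : MeasurableSet A)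
    (l m : ℕ) : μ.real (avoiding T A l) - μ.real (avoiding T A m) ≤ ((m - l : ℕ) : ℝ) * μ.real A := by
  refine (measureReal_sub_le_of_subset_union
    (D := ⋃ j ∈ Finset.Ico l m, T^[j] ⁻¹' A) fun x hx => ?_).trans ?_
  · by_cases h : x ∈ avoiding T A m
    · exact Or.inl h
    · right
      simp only [avoiding, Set.mem_ofPred_eq, not_forall, not_not] at h
      obtain ⟨j, hj, hjA⟩ := h
      simp only [Set.mem_iUnion, Finset.mem_Ico, exists_prop]
      exact ⟨j, ⟨not_lt.1 fun hjl => hx j hjl hjA, hj⟩, hjA⟩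
  · refine (measureReal_biUnion_finset_le _ _).trans (le_of_eq ?_)
    simp_rw [(hT.iterate _).measureReal_preimage hA.nullMeasurableSet]
    rw [Finset.sum_const, Nat.card_Ico, nsmul_eq_mul]

/-- Invariance splits `W_l` into `W_{l+1}` and a copy of `A ∩ T⁻¹ W_l`. Forgetting the times before
`t` costs the short returns, decorrelation costs `γ`, and restoring `W_l` costs `t μ(A)²`. For `t >
l` the truncated difference is zero and nothing remains to be avoided after the gap. -/
theorem abs_avoiding_succ_sub_le (hT : MeasurePreserving T μ μ) (hA : MeasurableSet A)
    {t : ℕ} (ht : 1 ≤ t) {γ : ℝ} (l : ℕ)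
    (hγ : |μ.real (A ∩ T^[t] ⁻¹' avoiding T A (l + 1 - t)) -
      μ.real A * μ.real (avoiding T A (l + 1 - t))| ≤ γ) :
    |μ.real (avoiding T A (l + 1)) - (1 - μ.real A) * μ.real (avoiding T A l)| ≤
      ∑ j ∈ Finset.Ico 1 t, μ.real (A ∩ T^[j] ⁻¹' A) + γ + t * μ.real A ^ 2 := by
  have hsplit : μ.real (avoiding T A l) =
      μ.real (A ∩ T ⁻¹' avoiding T A l) + μ.real (avoiding T A (l + 1)) := by
    rw [← hT.measureReal_preimage (measurableSet_avoiding hT.measurable hA l).nullMeasurableSet,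
      ← measureReal_inter_add_sdiff (s := T ⁻¹' avoiding T A l) hA, Set.inter_comm]
    congr 2
    ext x
    constructor
    · rintro ⟨h1, h2⟩ j hj
      cases j with
      | zero => exact h2
      | succ j => exact h1 j (by omega)
    · exact fun h => ⟨fun j hj => h (j + 1) (by omega), h 0 (by omega)⟩
  have h1 : μ.real (A ∩ T ⁻¹' avoiding T A l) ≤ μ.real (A ∩ T^[t] ⁻¹' avoiding T A (l + 1 - t)) := by
    refine measureReal_mono fun x hx => ⟨hx.1, fun j hj => ?_⟩
    rw [← Function.iterate_add_apply]
    have := hx.2 (j + t - 1) (by omega)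
    rwa [← Function.iterate_succ_apply, Nat.succ_eq_add_one, Nat.sub_add_cancel (by omega)] at this
  have h2 : μ.real (A ∩ T^[t] ⁻¹' avoiding T A (l + 1 - t)) - μ.real (A ∩ T ⁻¹' avoiding T A l) ≤
      ∑ j ∈ Finset.Ico 1 t, μ.real (A ∩ T^[j] ⁻¹' A) := by
    refine (measureReal_sub_le_of_subset_union
      (D := ⋃ j ∈ Finset.Ico 1 t, A ∩ T^[j] ⁻¹' A) fun x hx => ?_).trans
      (measureReal_biUnion_finset_le _ _)
    by_cases h : T x ∈ avoiding T A l
    · exact Or.inl ⟨hx.1, h⟩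
    · right
      simp only [avoiding, Set.mem_ofPred_eq, not_forall, not_not] at h
      obtain ⟨j, hj, hjA⟩ := h
      rw [← Function.iterate_succ_apply, Nat.succ_eq_add_one] at hjA
      simp only [Set.mem_iUnion, Finset.mem_Ico, exists_prop]
      refine ⟨j + 1, ⟨by omega, ?_⟩, hx.1, hjA⟩
      by_contra hjt
      refine hx.2 (j + 1 - t) (by omega) ?_
      rwa [← Function.iterate_add_apply, Nat.sub_add_cancel (by omega)]
  have h3 : μ.real (avoiding T A l) ≤ μ.real (avoiding T A (l + 1 - t)) :=
    measureReal_mono (avoiding_anti (by omega))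
  have h4 : μ.real (avoiding T A (l + 1 - t)) - μ.real (avoiding T A l) ≤ t * μ.real A := by
    refine (measureReal_avoiding_sub_le hT hA _ _).trans ?_
    gcongr
    omega
  have ha : 0 ≤ μ.real A := measureReal_nonneg
  have h5 := mul_le_mul_of_nonneg_left h4 ha
  have h6 := mul_le_mul_of_nonneg_left h3 ha
  have h7 := abs_le.1 hγ
  have h8 : (0 : ℝ) ≤ t * μ.real A ^ 2 := by positivity
  rw [abs_le]
  constructor <;> nlinarith

theorem abs_avoiding_sub_pow_le {a e : ℝ} (ha : 0 ≤ a) (ha1 : a ≤ 1) (n : ℕ)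
    (h : ∀ l < n, |μ.real (avoiding T A (l + 1)) - (1 - a) * μ.real (avoiding T A l)| ≤ e) :
    |μ.real (avoiding T A n) - (1 - a) ^ n| ≤ n * e := by
  induction n with
  | zero => simp [avoiding]
  | succ n ih =>
    have h1 := ih fun l hl => h l (by omega)
    have h2 := h n (by omega)
    have h3 : |(1 - a) * (μ.real (avoiding T A n) - (1 - a) ^ n)| ≤ n * e := by
      rw [abs_mul, abs_of_nonneg (by linarith : 0 ≤ 1 - a)]
      exact (mul_le_of_le_one_left (abs_nonneg _) (by linarith)).trans h1
    have h4 := abs_add_le (μ.real (avoiding T A (n + 1)) - (1 - a) * μ.real (avoiding T A n))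
      ((1 - a) * (μ.real (avoiding T A n) - (1 - a) ^ n))
    calc _ = |μ.real (avoiding T A (n + 1)) - (1 - a) * μ.real (avoiding T A n) +
          (1 - a) * (μ.real (avoiding T A n) - (1 - a) ^ n)| := by congr 1; ring
      _ ≤ _ := by push_cast; linarith

/-- Rare events `A n` with `n μ (A n) → β` that do not cluster and mix have an exponential
hitting-time law. -/
theorem tendsto_measureReal_avoiding (hT : MeasurePreserving T μ μ) {A : ℕ → Set X}
    (hA : ∀ᶠ n in atTop, MeasurableSet (A n)) {β : ℝ}
    (hβ : Tendsto (fun n : ℕ => n * μ.real (A n)) atTop (𝓝 β))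
    {t : ℕ → ℕ} (ht : ∀ᶠ n in atTop, 1 ≤ t n)
    (htn : Tendsto (fun n : ℕ => (t n : ℝ) / n) atTop (𝓝 0))
    (hD : Tendsto (fun n : ℕ => n * ∑ j ∈ Finset.Ico 1 (t n), μ.real (A n ∩ T^[j] ⁻¹' A n))
      atTop (𝓝 0))
    {γ : ℕ → ℝ} (hγ : Tendsto (fun n : ℕ => n * γ n) atTop (𝓝 0))
    (hmix : ∀ᶠ n in atTop, ∀ l ≤ n, |μ.real (A n ∩ T^[t n] ⁻¹' avoiding T (A n) l) -
      μ.real (A n) * μ.real (avoiding T (A n) l)| ≤ γ n) :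
    Tendsto (fun n => μ.real (avoiding T (A n) n)) atTop (𝓝 (Real.exp (-β))) := by
  have hpow : Tendsto (fun n : ℕ => (1 - μ.real (A n)) ^ n) atTop (𝓝 (Real.exp (-β))) := by
    have := Real.tendsto_one_add_pow_exp_of_tendsto (g := fun n => -μ.real (A n)) (t := -β)
      (by simpa using hβ.neg)
    simpa [← sub_eq_add_neg] using this
  have herr : Tendsto (fun n : ℕ => n * (∑ j ∈ Finset.Ico 1 (t n), μ.real (A n ∩ T^[j] ⁻¹' A n) +
      γ n + t n * μ.real (A n) ^ 2)) atTop (𝓝 0) := by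
    -- The last error, times `n`, is `(n μ(A n))² (t n / n)`.
    have h1 := (hD.add hγ).add ((hβ.mul hβ).mul htn)
    rw [mul_zero, add_zero, add_zero] at h1
    refine h1.congr' ?_
    filter_upwards [eventually_gt_atTop 0] with n hn
    have : (n : ℝ) ≠ 0 := by positivity
    field_simp
  have hdiff : Tendsto (fun n => μ.real (avoiding T (A n) n) - (1 - μ.real (A n)) ^ n) atTop
      (𝓝 0) := by
    refine squeeze_zero_norm' ?_ herr
    filter_upwards [hA, ht, hmix] with n h1 h2 h3
    exact abs_avoiding_sub_pow_le measureReal_nonneg measureReal_le_one n fun l hl =>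
      abs_avoiding_succ_sub_le hT h1 h2 l (h3 _ (by omega))
  simpa using hdiff.add hpow

end avoiding

/-! ### Hitting times of small targets of a toral automorphism -/

theorem tendsto_pow_mul_pow_sqrt {ρ : ℝ} (h0 : 0 ≤ ρ) (h1 : ρ < 1) :
    Tendsto (fun n : ℕ => (n : ℝ) ^ 2 * (n + 1) * ρ ^ n.sqrt) atTop (𝓝 0) := by
  have hs : Tendsto Nat.sqrt atTop atTop :=
    tendsto_atTop.2 fun b => by
      filter_upwards [eventually_ge_atTop (b * b)] with n hn
      exact Nat.le_sqrt.2 hn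
  have h2 := ((tendsto_pow_const_mul_const_pow_of_lt_one 6 h0 h1).comp hs).const_mul 1024
  rw [mul_zero] at h2
  refine squeeze_zero' (Eventually.of_forall fun n => by positivity) ?_ h2
  filter_upwards [eventually_ge_atTop 1] with n hn
  have hk : (1 : ℝ) ≤ n.sqrt := by exact_mod_cast Nat.sqrt_pos.2 hn
  have hn1 : (n : ℝ) ≤ 4 * (n.sqrt : ℝ) ^ 2 := by
    have : (n : ℝ) ≤ n.sqrt * n.sqrt + n.sqrt + n.sqrt := by exact_mod_cast Nat.sqrt_le_add n
    nlinarith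
  have hn2 : (n : ℝ) + 1 ≤ 8 * (n.sqrt : ℝ) ^ 2 := by nlinarith
  simp only [Function.comp]
  rw [← mul_assoc]
  refine mul_le_mul_of_nonneg_right ?_ (by positivity)
  calc (n : ℝ) ^ 2 * (n + 1) ≤ (4 * (n.sqrt : ℝ) ^ 2) ^ 2 * (8 * (n.sqrt : ℝ) ^ 2) := by gcongr
    _ ≤ 1024 * (n.sqrt : ℝ) ^ 6 := by nlinarith [pow_nonneg (zero_le_one.trans hk) 6]

theorem tendsto_two_mul_sqrt_div : Tendsto (fun n : ℕ => ((2 * n.sqrt : ℕ) : ℝ) / n) atTop (𝓝 0) := by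
  have hs : Tendsto (fun n : ℕ => 2 / Real.sqrt n) atTop (𝓝 0) :=
    tendsto_const_nhds.div_atTop (Real.tendsto_sqrt_atTop.comp tendsto_natCast_atTop_atTop)
  refine squeeze_zero' (Eventually.of_forall fun n => by positivity) ?_ hs
  filter_upwards [eventually_gt_atTop 0] with n hn
  have h1 : (0 : ℝ) < n := by exact_mod_cast hn
  rw [div_le_div_iff₀ h1 (Real.sqrt_pos.2 h1)]
  have h2 : (n.sqrt : ℝ) ≤ Real.sqrt n := Real.nat_sqrt_le_real_sqrt
  have h3 := Real.mul_self_sqrt h1.le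
  push_cast
  nlinarith [Real.sqrt_nonneg n]

namespace IsHyperbolicPair
variable {h : ℝ × ℝ →+ UnitAddTorus (Fin 2)} {lam : ℝ}
  {T S : UnitAddTorus (Fin 2) →+ UnitAddTorus (Fin 2)} (H : IsHyperbolicPair h lam T S)
include H

theorem inv_iterate_iterate (k : ℕ) (z : UnitAddTorus (Fin 2)) : S^[k] (T^[k] z) = z :=
  Function.LeftInverse.iterate H.inv_map k z

/-- Applying `T^k` to the first set and `T^{-k}` to the second shrinks the relevant translations by
`|λ|^{-k}`. The factor `l` counts the times at which a stable translation can bring the orbit into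
the target. -/
theorem abs_mixing_le (c : TorusChart h) (ζ : UnitAddTorus (Fin 2)) {α r : ℝ} (hα : 0 ≤ α)
    (hα1 : α ≤ 1) (hr : 0 < r) (hrc : r ≤ c.radius) {R : ℝ} (hR : c.bound ≤ R) (k l : ℕ) :
    |volume.real (target h ζ α r ∩ T^[2 * k] ⁻¹' avoiding T (target h ζ α r) l) -
      volume.real (target h ζ α r) * volume.real (avoiding T (target h ζ α r) l)| ≤
      c.density * (8 * r * (|lam⁻¹| ^ k * R)) * (1 + l) +
        3 * c.bound * volume.real (target h ζ α r) / R := by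
  set A := target h ζ α r
  have hA : MeasurableSet A := c.measurableSet_target hrc
  have hW : MeasurableSet (avoiding T A l) :=
    measurableSet_avoiding H.measurePreserving.measurable hA l
  have hTk := H.measurePreserving.iterate k
  have hSk := H.measurePreserving_inv.iterate k
  have hq0 : 0 ≤ |lam⁻¹| := abs_nonneg _
  have e1 : volume.real (A ∩ T^[2 * k] ⁻¹' avoiding T A l) =
      volume.real (S^[k] ⁻¹' A ∩ T^[k] ⁻¹' avoiding T A l) := by
    rw [← hTk.measureReal_preimage ((hSk.measurable hA).inter (hTk.measurable hW)).nullMeasurableSet]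
    congr 1
    ext z
    simp only [Set.mem_inter_iff, Set.mem_preimage, H.inv_iterate_iterate, two_mul,
      Function.iterate_add_apply]
  have e2 : volume.real A = volume.real (S^[k] ⁻¹' A) :=
    (hSk.measureReal_preimage hA.nullMeasurableSet).symm
  have e3 : volume.real (avoiding T A l) = volume.real (T^[k] ⁻¹' avoiding T A l) :=
    (hTk.measureReal_preimage hW.nullMeasurableSet).symm
  have hmA : ∀ g, MeasurableSet {z | z ∈ A ∧ z + g ∉ A} := fun g =>
    hA.inter ((measurable_add_const g) hA).compl
  have hmA' : ∀ g, MeasurableSet {z | z + g ∈ A ∧ z ∉ A} := fun g =>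
    ((measurable_add_const g) hA).inter hA.compl
  have key := c.abs_correlation_le (P := S^[k] ⁻¹' A) (E := T^[k] ⁻¹' avoiding T A l)
    (e₁ := c.density * (8 * r * (|lam⁻¹| ^ k * R)))
    (e₂ := l * (c.density * (8 * r * (|lam⁻¹| ^ k * R)))) (hSk.measurable hA) hR ?_ ?_
  · rw [← e1, ← e2, ← e3] at key
    exact key.trans (le_of_eq (by ring))
  · intro a ha
    have h1 : {z | z ∈ S^[k] ⁻¹' A ∧ z + h (a, 0) ∉ S^[k] ⁻¹' A} =
        S^[k] ⁻¹' {z | z ∈ A ∧ z + h (lam⁻¹ ^ k * a, 0) ∉ A} := by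
      ext z
      simp only [Set.mem_ofPred_eq, Set.mem_preimage, iterate_map_add, H.symm_pow_chart, mul_zero]
    rw [h1, hSk.measureReal_preimage (hmA _).nullMeasurableSet]
    refine (c.measureReal_shift_fst_le hα hr hrc _).trans ?_
    rw [abs_mul, abs_pow]
    have := c.density_pos
    gcongr
  · intro b hb
    have h1 : {z | z ∈ T^[k] ⁻¹' avoiding T A l ∧ z + h (0, b) ∉ T^[k] ⁻¹' avoiding T A l} ⊆
        ⋃ j ∈ Finset.range l, T^[j + k] ⁻¹' {z | z + h (0, lam⁻¹ ^ (j + k) * b) ∈ A ∧ z ∉ A} := by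
      rintro z ⟨h2, h3⟩
      simp only [avoiding, Set.mem_preimage, Set.mem_ofPred_eq, not_forall, not_not] at h2 h3
      obtain ⟨j, hj, hjA⟩ := h3
      rw [← Function.iterate_add_apply, iterate_map_add, H.pow_chart, mul_zero] at hjA
      simp only [Set.mem_iUnion, Finset.mem_range, exists_prop]
      refine ⟨j, hj, hjA, ?_⟩
      rw [Function.iterate_add_apply]
      exact h2 j hj
    refine (measureReal_mono h1 (measure_ne_top _ _)).trans
      ((measureReal_biUnion_finset_le _ _).trans ?_)
    refine (Finset.sum_le_card_nsmul _ _ (c.density * (8 * r * (|lam⁻¹| ^ k * R))) ?_).trans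
      (le_of_eq (by rw [Finset.card_range, nsmul_eq_mul]))
    intro j _
    rw [(H.measurePreserving.iterate (j + k)).measureReal_preimage (hmA' _).nullMeasurableSet]
    set δ := lam⁻¹ ^ (j + k) * b
    have h4 : {z | z + h (0, δ) ∈ A ∧ z ∉ A} =
        {z | z + h (0, δ) ∈ A ∧ z + h (0, δ) + h (0, -δ) ∉ A} := by
      ext z
      rw [Set.mem_ofPred_eq, Set.mem_ofPred_eq, add_assoc, ← map_add, Prod.mk_add_mk,
        add_neg_cancel, add_zero, ← Prod.zero_eq_mk, map_zero, add_zero]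
    rw [h4, measureReal_setOf_add (fun z => z ∈ A ∧ z + h (0, -δ) ∉ A)]
    refine (c.measureReal_shift_snd_le hα hα1 hr hrc _).trans ?_
    have := c.density_pos
    have h5 : |lam⁻¹| ^ (j + k) ≤ |lam⁻¹| ^ k :=
      pow_le_pow_of_le_one hq0 H.inv_lt_one.le (by omega)
    rw [abs_neg, abs_mul, abs_pow]
    gcongr

theorem tendsto_sum_returns (c : TorusChart h) {η : ℝ} (hη : 0 < η)
    (hker : ∀ w, h w = 0 → w ≠ 0 → η ≤ |w.1| * |w.2|) {ζ : UnitAddTorus (Fin 2)} {α : ℝ}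
    (hret : ∀ j, 1 ≤ j → T^[j] ζ = ζ → 1 ≤ α * |lam| ^ j) {r : ℕ → ℝ}
    (hr : ∀ n, 0 < r n) (hr0 : Tendsto r atTop (𝓝 0)) {b : ℝ}
    (hb : Tendsto (fun n : ℕ => n * r n ^ 2) atTop (𝓝 b)) {t : ℕ → ℕ}
    (htn : Tendsto (fun n : ℕ => (t n : ℝ) / n) atTop (𝓝 0)) :
    Tendsto (fun n : ℕ => n * ∑ j ∈ Finset.Ico 1 (t n),
      volume.real (target h ζ α (r n) ∩ T^[j] ⁻¹' target h ζ α (r n))) atTop (𝓝 0) := by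
  set q := |lam⁻¹|
  have hq0 : 0 ≤ q := abs_nonneg _
  have hq1 : q < 1 := H.inv_lt_one
  have hκ := c.density_pos
  -- Times below `G` contribute nothing for large `n`; the rest is a geometric tail plus `t` terms
  -- of order `r⁴`. First `n → ∞`, then `G` is large.
  have key : ∀ G : ℕ, 1 ≤ G → ∀ᶠ n : ℕ in atTop,
      n * ∑ j ∈ Finset.Ico 1 (t n),
        volume.real (target h ζ α (r n) ∩ T^[j] ⁻¹' target h ζ α (r n)) ≤
      (n * r n ^ 2) * (c.density * 4 / (1 - q)) * q ^ G +
        (n * r n ^ 2) * (n * r n ^ 2) * (t n / n) * (c.density * 64 / η) := by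
    intro G hG
    have hno : ∀ᶠ n in atTop, ∀ j ∈ Finset.Ico 1 G,
        ∀ z ∈ target h ζ α (r n), T^[j] z ∉ target h ζ α (r n) := by
      refine (Filter.eventually_all_finset _).2 fun j hj => hr0.eventually
        (H.eventually_no_return c (hret j (Finset.mem_Ico.1 hj).1))
    have hsm : ∀ᶠ n in atTop, 16 * r n ^ 2 < η := by
      have : Tendsto (fun n => 16 * r n ^ 2) atTop (𝓝 (16 * 0 ^ 2)) := (hr0.pow 2).const_mul 16
      exact this.eventually (gt_mem_nhds (by simpa using hη))
    filter_upwards [hno, hsm, hr0.eventually (gt_mem_nhds c.radius_pos), eventually_gt_atTop 0]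
      with n hn1 hn2 hn3 hn0
    have hn0' : (0 : ℝ) < n := by exact_mod_cast hn0
    set f : ℕ → ℝ := fun j => volume.real (target h ζ α (r n) ∩ T^[j] ⁻¹' target h ζ α (r n))
    have hf : ∀ j, f j ≤ c.density * (4 * r n ^ 2 * q ^ j + 64 * r n ^ 4 / η) := by
      intro j
      have hsub : target h ζ α (r n) ∩ T^[j] ⁻¹' target h ζ α (r n) ⊆
          {z | z ∈ target h ζ 0 (r n) ∧ T^[j] z ∈ target h ζ 0 (r n)} :=
        fun z hz => ⟨target_subset _ _ _ _ hz.1, target_subset _ _ _ _ hz.2⟩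
      exact (measureReal_mono hsub).trans
        (H.measureReal_return_le c hη hker ζ (hr n) hn3.le hn2 j)
    have hsum : ∑ j ∈ Finset.Ico 1 (t n), f j ≤ ∑ j ∈ Finset.Ico G (t n), f j := by
      rw [← Finset.sum_filter_of_ne (p := fun j => G ≤ j)]
      · refine Finset.sum_le_sum_of_subset_of_nonneg (fun j hj => ?_)
          fun _ _ _ => measureReal_nonneg
        simp only [Finset.mem_filter, Finset.mem_Ico] at hj ⊢
        exact ⟨hj.2, hj.1.2⟩
      · intro j hj hne
        by_contra hjG
        refine hne ?_
        have hempty : target h ζ α (r n) ∩ T^[j] ⁻¹' target h ζ α (r n) = ∅ :=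
          Set.eq_empty_of_forall_notMem fun z hz =>
            hn1 j (Finset.mem_Ico.2 ⟨(Finset.mem_Ico.1 hj).1, not_le.1 hjG⟩) z hz.1 hz.2
        simp only [f, hempty, measureReal_empty]
    have hgeo : ∑ j ∈ Finset.Ico G (t n), q ^ j ≤ q ^ G / (1 - q) :=
      geom_sum_Ico_le_of_lt_one hq0 hq1
    have hcard : ((Finset.Ico G (t n)).card : ℝ) ≤ t n := by
      rw [Nat.card_Ico]; exact_mod_cast Nat.sub_le _ _
    have htot : ∑ j ∈ Finset.Ico 1 (t n), f j ≤
        c.density * (4 * r n ^ 2 * (q ^ G / (1 - q)) + t n * (64 * r n ^ 4 / η)) := by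
      refine hsum.trans ((Finset.sum_le_sum fun j _ => hf j).trans ?_)
      rw [← Finset.mul_sum, Finset.sum_add_distrib, ← Finset.mul_sum, Finset.sum_const,
        nsmul_eq_mul]
      gcongr
    refine (mul_le_mul_of_nonneg_left htot hn0'.le).trans (le_of_eq ?_)
    have : 1 - q ≠ 0 := by linarith
    field_simp
  rw [Metric.tendsto_atTop']
  intro ε hε
  have hG : Tendsto (fun G : ℕ => b * (c.density * 4 / (1 - q)) * q ^ G) atTop (𝓝 0) := by
    simpa using (tendsto_pow_atTop_nhds_zero_of_lt_one hq0 hq1).const_mul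
      (b * (c.density * 4 / (1 - q)))
  obtain ⟨G, hGε, hG1⟩ := ((hG.eventually (gt_mem_nhds hε)).and (eventually_ge_atTop 1)).exists
  have hlim : Tendsto (fun n : ℕ => (n * r n ^ 2) * (c.density * 4 / (1 - q)) * q ^ G +
      (n * r n ^ 2) * (n * r n ^ 2) * (t n / n) * (c.density * 64 / η)) atTop
      (𝓝 (b * (c.density * 4 / (1 - q)) * q ^ G + b * b * 0 * (c.density * 64 / η))) :=
    ((hb.mul_const _).mul_const _).add (((hb.mul hb).mul htn).mul_const _)
  rw [mul_zero, zero_mul, add_zero] at hlim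
  obtain ⟨N, hN⟩ := eventually_atTop.1 ((key G hG1).and (hlim.eventually (gt_mem_nhds hGε)))
  refine ⟨N, fun n hn => ?_⟩
  rw [Real.dist_0_eq_abs, abs_of_nonneg
    (mul_nonneg n.cast_nonneg (Finset.sum_nonneg fun _ _ => measureReal_nonneg))]
  exact (hN n hn.le).1.trans_lt (hN n hn.le).2

/-- The law of the hitting time of small targets that contain no orbit segment of bounded length
with both ends in them. -/
theorem tendsto_avoiding_target (c : TorusChart h) {η : ℝ} (hη : 0 < η)
    (hker : ∀ w, h w = 0 → w ≠ 0 → η ≤ |w.1| * |w.2|) {ζ : UnitAddTorus (Fin 2)} {α : ℝ}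
    (hα : 0 ≤ α) (hα1 : α ≤ 1)
    (hret : ∀ j, 1 ≤ j → T^[j] ζ = ζ → 1 ≤ α * |lam| ^ j) {r : ℕ → ℝ}
    (hr : ∀ n, 0 < r n) (hr0 : Tendsto r atTop (𝓝 0)) {b : ℝ}
    (hb : Tendsto (fun n : ℕ => n * r n ^ 2) atTop (𝓝 b)) :
    Tendsto (fun n => volume.real (avoiding T (target h ζ α (r n)) n)) atTop
      (𝓝 (Real.exp (-(c.density * (4 * (1 - α)) * b)))) := by
  have hsmall : ∀ᶠ n in atTop, r n ≤ c.radius :=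
    (hr0.eventually (gt_mem_nhds c.radius_pos)).mono fun _ => le_of_lt
  have hmeas : ∀ᶠ n in atTop, volume.real (target h ζ α (r n)) =
      c.density * (4 * (1 - α) * r n ^ 2) :=
    hsmall.mono fun n hn => c.measureReal_target hα hα1 (hr n) hn
  have hA0 : Tendsto (fun n => volume.real (target h ζ α (r n))) atTop (𝓝 0) := by
    have : Tendsto (fun n => c.density * (4 * (1 - α) * r n ^ 2)) atTop
        (𝓝 (c.density * (4 * (1 - α) * 0 ^ 2))) := ((hr0.pow 2).const_mul _).const_mul _
    simp only [ne_eq, OfNat.ofNat_ne_zero, not_false_eq_true, zero_pow, mul_zero] at this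
    exact this.congr' (hmeas.mono fun _ => Eq.symm)
  -- Lag `2⌊√n⌋` and square of half-side `n`: the lag is `o(n)`, yet `|λ|^{-⌊√n⌋}` beats the cubic
  -- factor, and the boundary error times `n` is a multiple of the target's measure.
  refine tendsto_measureReal_avoiding H.measurePreserving (t := fun n => 2 * n.sqrt)
    (γ := fun n : ℕ => c.density * (8 * r n * (|lam⁻¹| ^ n.sqrt * n)) * (1 + n) +
        3 * c.bound * volume.real (target h ζ α (r n)) / n)
    (hsmall.mono fun n hn => c.measurableSet_target hn) ?_ ?_ tendsto_two_mul_sqrt_div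
    (H.tendsto_sum_returns c hη hker hret hr hr0 hb tendsto_two_mul_sqrt_div) ?_ ?_
  · refine (hb.const_mul (c.density * (4 * (1 - α)))).congr' ?_
    filter_upwards [hmeas] with n hn
    rw [hn]; ring
  · filter_upwards [eventually_ge_atTop 1] with n hn
    have := Nat.sqrt_pos.2 hn
    omega
  · have h1 := (((hr0.const_mul (8 * c.density)).mul
      (tendsto_pow_mul_pow_sqrt (abs_nonneg lam⁻¹) H.inv_lt_one))).add
      (hA0.const_mul (3 * c.bound))
    rw [mul_zero, mul_zero, add_zero] at h1
    refine h1.congr' ?_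
    filter_upwards [eventually_gt_atTop 0] with n hn
    have : (n : ℝ) ≠ 0 := by positivity
    field_simp
    ring
  · have hbd : ∀ᶠ n : ℕ in atTop, c.bound ≤ n :=
      tendsto_natCast_atTop_atTop.eventually_ge_atTop c.bound
    filter_upwards [hsmall, hbd] with n h1 h2 l hl
    refine (H.abs_mixing_le c ζ hα hα1 (hr n) h1 h2 n.sqrt l).trans ?_
    have := c.density_pos
    have := hr n
    have : (l : ℝ) ≤ n := by exact_mod_cast hl
    gcongr

end IsHyperbolicPair

/-! ### The extreme value law -/

/-- The strict inequality gives the open box, so the infimum defining `dStar` need not be attained.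
-/
theorem lt_observable_iff {eu es : EuclideanSpace ℝ (Fin 2)} {ζ z : UnitAddTorus (Fin 2)} (u : ℝ)
    (hsurj : Function.Surjective (basisHom eu es)) :
    (u : EReal) < observable eu es ζ z ↔
      z ∈ target (basisHom eu es) ζ 0 (Real.exp (-u)) := by
  have h1 : ((u : EReal) < observable eu es ζ z) ↔ dStar eu es z ζ < Real.exp (-u) := by
    rw [observable, EReal.lt_neg_comm, ← EReal.coe_neg, ← EReal.log_exp ((-u : ℝ) : EReal),
      ENNReal.log_lt_log_iff, EReal.exp_coe, ENNReal.ofReal_lt_ofReal_iff (Real.exp_pos _)]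
  have hbdd : BddBelow {r : ℝ | ∃ xu xs : ℝ,
      torusProj (xu • eu + xs • es) = z - ζ ∧ r = max |xu| |xs|} := by
    refine ⟨0, ?_⟩
    rintro _ ⟨xu, xs, -, rfl⟩
    exact (abs_nonneg xu).trans (le_max_left _ _)
  have hne : {r : ℝ | ∃ xu xs : ℝ,
      torusProj (xu • eu + xs • es) = z - ζ ∧ r = max |xu| |xs|}.Nonempty := by
    obtain ⟨w, hw⟩ := hsurj (z - ζ)
    exact ⟨_, w.1, w.2, hw, rfl⟩
  rw [h1, dStar, csInf_lt_iff hbdd hne]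
  constructor
  · rintro ⟨_, ⟨xu, xs, hx, rfl⟩, hlt⟩
    obtain ⟨hu, hs⟩ := max_lt_iff.1 hlt
    refine ⟨(xu, xs), ⟨⟨by simp, hu⟩, ⟨by simp, hs⟩⟩, ?_⟩
    have : basisHom eu es (xu, xs) = z - ζ := hx
    simp only [this, add_sub_cancel]
  · rintro ⟨w, hw, rfl⟩
    exact ⟨_, ⟨w.1, w.2, (add_sub_cancel_left ζ (basisHom eu es w)).symm, rfl⟩,
      max_lt hw.1.2 hw.2.2⟩

theorem setOf_partialMax_le {L : Matrix (Fin 2) (Fin 2) ℤ} {eu es : EuclideanSpace ℝ (Fin 2)}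
    {ζ : UnitAddTorus (Fin 2)} (u : ℝ) (hsurj : Function.Surjective (basisHom eu es)) (n : ℕ) :
    {z | partialMax L eu es ζ n z ≤ (u : EReal)} =
      avoiding (toralMap L) (target (basisHom eu es) ζ 0 (Real.exp (-u))) n := by
  ext z
  simp only [partialMax, process, avoiding, Set.mem_ofPred_eq, Finset.sup_le_iff, Finset.mem_range,
    ← lt_observable_iff u hsurj, not_lt]

theorem target_mono (h : ℝ × ℝ →+ UnitAddTorus (Fin 2)) (ζ : UnitAddTorus (Fin 2)) {r s : ℝ}
    (hrs : r ≤ s) : target h ζ 0 r ⊆ target h ζ 0 s := by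
  rintro _ ⟨w, hw, rfl⟩
  exact ⟨w, ⟨⟨by simp, hw.1.2.trans_le hrs⟩, ⟨by simp, hw.2.2.trans_le hrs⟩⟩, rfl⟩

theorem tendsto_zero_of_tendsto_mul {a : ℕ → ℝ} {τ : ℝ}
    (h : Tendsto (fun n : ℕ => n * a n) atTop (𝓝 τ)) : Tendsto a atTop (𝓝 0) := by
  have h1 := h.mul tendsto_inv_atTop_nhds_zero_nat
  rw [mul_zero] at h1
  refine h1.congr' ?_
  filter_upwards [eventually_gt_atTop 0] with n hn
  have : (n : ℝ) ≠ 0 := by positivity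
  field_simp

namespace TorusChart
variable {h : ℝ × ℝ →+ UnitAddTorus (Fin 2)} (c : TorusChart h) {ζ : UnitAddTorus (Fin 2)}
  {r : ℕ → ℝ} {τ : ℝ}
include c

/-- The area formula holds only below the chart radius, so monotonicity is used: a radius staying
above `s` would keep the measure above that of the `s`-box. -/
theorem tendsto_radius_zero (hr : ∀ n, 0 < r n)
    (hτ : Tendsto (fun n : ℕ => n * volume.real (target h ζ 0 (r n))) atTop (𝓝 τ)) :
    Tendsto r atTop (𝓝 0) := by
  have h0 := tendsto_zero_of_tendsto_mul hτ
  rw [Metric.tendsto_atTop']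
  intro ε hε
  set s := min ε c.radius
  have hs : 0 < s := lt_min hε c.radius_pos
  have hpos : 0 < volume.real (target h ζ 0 s) := by
    rw [c.measureReal_target le_rfl zero_le_one hs (min_le_right _ _)]
    have := c.density_pos
    simp only [sub_zero]
    positivity
  obtain ⟨N, hN⟩ := eventually_atTop.1 (h0.eventually (gt_mem_nhds hpos))
  refine ⟨N, fun n hn => ?_⟩
  rw [Real.dist_0_eq_abs, abs_of_pos (hr n)]
  by_contra! hle
  exact absurd (hN n hn.le) (not_lt.2
    (measureReal_mono (target_mono h ζ ((min_le_left _ _).trans hle))))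

theorem tendsto_mul_radius_sq (hr : ∀ n, 0 < r n)
    (hτ : Tendsto (fun n : ℕ => n * volume.real (target h ζ 0 (r n))) atTop (𝓝 τ)) :
    Tendsto (fun n : ℕ => n * r n ^ 2) atTop (𝓝 (τ / (4 * c.density))) := by
  refine (hτ.div_const (4 * c.density)).congr' ?_
  filter_upwards [(c.tendsto_radius_zero hr hτ).eventually (gt_mem_nhds c.radius_pos)] with n hn
  have := c.density_pos.ne'
  rw [c.measureReal_target le_rfl zero_le_one (hr n) hn.le]
  field_simp
  ring

end TorusChart

/-- Near a periodic point a box is left only through its exit ring, so that avoiding the ring and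
avoiding the box are asymptotically equivalent. -/
theorem IsHyperbolicPair.abs_avoiding_target_sub_le {h : ℝ × ℝ →+ UnitAddTorus (Fin 2)} {lam : ℝ}
    {T S : UnitAddTorus (Fin 2) →+ UnitAddTorus (Fin 2)} (H : IsHyperbolicPair h lam T S)
    (c : TorusChart h) {ζ : UnitAddTorus (Fin 2)} {q : ℕ} (hq : 0 < q) (hζ : T^[q] ζ = ζ) {r : ℝ}
    (hrc : r ≤ c.radius) (n : ℕ) :
    |volume.real (avoiding T (target h ζ 0 r) n) -
      volume.real (avoiding T (target h ζ (|lam| ^ q)⁻¹ r) n)| ≤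
      q * volume.real (target h ζ 0 r) := by
  have hlq : 0 < |lam| ^ q := pow_pos (abs_pos.2 H.ne_zero) q
  -- Off the ring, `|λ|^q |x^u| < r`, and the stable coordinate only shrinks.
  have hexit : ∀ z ∈ target h ζ 0 r, z ∉ target h ζ (|lam| ^ q)⁻¹ r →
      T^[q] z ∈ target h ζ 0 r := by
    rintro _ ⟨w, hw, rfl⟩ h2
    refine ⟨(lam ^ q * w.1, lam⁻¹ ^ q * w.2), ⟨⟨?_, ?_⟩, ⟨?_, ?_⟩⟩, ?_⟩
    · rw [zero_mul]; exact abs_nonneg _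
    · rw [abs_mul, abs_pow]
      by_contra! hle
      refine h2 ⟨w, ⟨⟨?_, hw.1.2⟩, hw.2⟩, rfl⟩
      rwa [inv_mul_le_iff₀ hlq]
    · rw [zero_mul]; exact abs_nonneg _
    · rw [abs_mul, abs_pow]
      exact (mul_le_of_le_one_left (abs_nonneg _)
        (pow_le_one₀ (abs_nonneg _) H.inv_lt_one.le)).trans_lt hw.2.2
    · simp only [H.iterate_add_chart, hζ]
  have h1 : volume.real (avoiding T (target h ζ 0 r) n) ≤
      volume.real (avoiding T (target h ζ (|lam| ^ q)⁻¹ r) n) :=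
    measureReal_mono fun z hz j hj hjA => hz j hj (target_subset _ _ _ _ hjA)
  rw [abs_sub_comm, abs_of_nonneg (sub_nonneg.2 h1)]
  refine (measureReal_sub_le_of_subset_union
    (D := ⋃ j ∈ Finset.Ico (n - q) n, T^[j] ⁻¹' target h ζ 0 r) fun z hz => ?_).trans
    ((measureReal_biUnion_finset_le _ _).trans ?_)
  · by_contra hnot
    simp only [Set.mem_union, not_or, Set.mem_iUnion, Finset.mem_Ico, exists_prop, not_exists,
      not_and, Set.mem_preimage] at hnot
    obtain ⟨h2, h3⟩ := hnot
    simp only [avoiding, Set.mem_ofPred_eq, not_forall, not_not] at h2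
    -- With no visit in the last `q` times, each visit forces another `q` steps later, still before
    -- `n`: visits would never end.
    have hinf : ∀ k, ∃ i, k ≤ i ∧ i < n ∧ T^[i] z ∈ target h ζ 0 r := by
      intro k
      induction k with
      | zero => obtain ⟨i, hi, hiA⟩ := h2; exact ⟨i, i.zero_le, hi, hiA⟩
      | succ k ih =>
        obtain ⟨i, hki, hin, hiA⟩ := ih
        have h4 : i + q < n := by
          by_contra hge
          exact h3 i ⟨by omega, hin⟩ hiA
        refine ⟨i + q, by omega, h4, ?_⟩
        rw [add_comm, Function.iterate_add_apply]
        exact hexit _ hiA (hz i hin)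
    obtain ⟨i, h5, h6, -⟩ := hinf n
    omega
  · simp_rw [(H.measurePreserving.iterate _).measureReal_preimage
      (c.measurableSet_target hrc).nullMeasurableSet]
    rw [Finset.sum_const, Nat.card_Ico, nsmul_eq_mul]
    gcongr
    omega

theorem theorem2
    (L : Matrix (Fin 2) (Fin 2) ℤ) (hL : IsHyperbolicMatrix L)
    -- the eigenvalues `lam`, `1 / lam` with unit eigenvectors `eu`, `es`
    (lam : ℝ) (hlam : 1 < |lam|)
    (eu es : EuclideanSpace ℝ (Fin 2)) (heu_norm : ‖eu‖ = 1) (hes_norm : ‖es‖ = 1)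
    (heu : (L.map (Int.cast : ℤ → ℝ)).mulVec eu.ofLp = lam • eu.ofLp)
    (hes : (L.map (Int.cast : ℤ → ℝ)).mulVec es.ofLp = lam⁻¹ • es.ofLp)
    (ζ : UnitAddTorus (Fin 2))
    (τ : ℝ) (hτ : 0 ≤ τ) (u : ℕ → ℝ)
    (hu : Tendsto
      (fun n : ℕ => (n : ℝ) * (volume : Measure (UnitAddTorus (Fin 2))).real
        {z | (u n : EReal) < process L eu es ζ 0 z}) atTop (𝓝 τ)) :
    (ζ ∉ Function.periodicPts (toralMap L) →
      Tendsto
        (fun n : ℕ => (volume : Measure (UnitAddTorus (Fin 2))).real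
          {z | partialMax L eu es ζ n z ≤ (u n : EReal)})
        atTop (𝓝 (Real.exp (-τ)))) ∧
    (∀ q : ℕ, 0 < q → Function.minimalPeriod (toralMap L) ζ = q →
      Tendsto
        (fun n : ℕ => (volume : Measure (UnitAddTorus (Fin 2))).real
          {z | partialMax L eu es ζ n z ≤ (u n : EReal)})
        atTop (𝓝 (Real.exp (-((1 - |lam| ^ (-(q : ℤ))) * τ))))) := by
  have hd := eigenbasis_det_ne_zero hlam heu_norm hes_norm heu hes
  set h := basisHom eu es
  let c : TorusChart h := basisChart hd
  have H : IsHyperbolicPair h lam (toralHom L) (toralHom L.adjugate) :=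
    isHyperbolicPair_toralHom hL.det_eq_one hlam heu hes
  obtain ⟨η, hη, hker⟩ := H.exists_le_abs_mul hd
  have hκ := c.density_pos
  set r : ℕ → ℝ := fun n => Real.exp (-u n)
  have hr : ∀ n, 0 < r n := fun n => Real.exp_pos _
  have hB : Tendsto (fun n : ℕ => n * volume.real (target h ζ 0 (r n))) atTop (𝓝 τ) := by
    refine hu.congr fun n => ?_
    congr 2
    ext z
    exact lt_observable_iff (u n) c.surjective
  have hr0 := c.tendsto_radius_zero hr hB
  have hb := c.tendsto_mul_radius_sq hr hB
  simp_rw [setOf_partialMax_le _ c.surjective]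
  constructor
  · intro hζ
    -- With `α = 0` the target is the full box, and the return condition is vacuous.
    have := H.tendsto_avoiding_target c hη hker (ζ := ζ) le_rfl zero_le_one
      (fun j hj hjζ => absurd (Function.mk_mem_periodicPts hj hjζ) hζ) hr hr0 hb
    have e : -τ = -(c.density * (4 * (1 - 0)) * (τ / (4 * c.density))) := by
      field_simp
      ring
    rw [e]
    exact this
  · intro q hq hζ
    have hper : (toralHom L)^[q] ζ = ζ := by
      rw [← hζ]; exact Function.iterate_minimalPeriod
    have hlq : 1 ≤ |lam| ^ q := one_le_pow₀ hlam.le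
    -- Every positive return time of `ζ` is a multiple of `q`, so `α = |λ|^{-q}` satisfies the
    -- return condition.
    have hring := H.tendsto_avoiding_target c hη hker (ζ := ζ) (α := (|lam| ^ q)⁻¹)
      (by positivity) (inv_le_one_of_one_le₀ hlq) (fun j hj hjζ => by
        have hqj : q ≤ j := by
          rw [← hζ]
          exact Nat.le_of_dvd hj (Function.IsPeriodicPt.minimalPeriod_dvd hjζ)
        rw [← div_eq_inv_mul, one_le_div (by positivity)]
        exact pow_le_pow_right₀ hlam.le hqj) hr hr0 hb
    have hdiff : Tendsto (fun n => volume.real (avoiding (toralHom L) (target h ζ 0 (r n)) n) -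
        volume.real (avoiding (toralHom L) (target h ζ (|lam| ^ q)⁻¹ (r n)) n)) atTop (𝓝 0) := by
      have h0 := (tendsto_zero_of_tendsto_mul hB).const_mul (q : ℝ)
      rw [mul_zero] at h0
      refine squeeze_zero_norm' ?_ h0
      filter_upwards [hr0.eventually (gt_mem_nhds c.radius_pos)] with n hn
      exact H.abs_avoiding_target_sub_le c hq hper hn.le n
    have hlim := hdiff.add hring
    simp only [sub_add_cancel, zero_add] at hlim
    have e : -((1 - |lam| ^ (-(q : ℤ))) * τ) =
        -(c.density * (4 * (1 - (|lam| ^ q)⁻¹)) * (τ / (4 * c.density))) := by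
      rw [zpow_neg, zpow_natCast]
      field_simp
    rw [e]
    exact hlim
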